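/- Let $\Theta\subseteq\mathbb R$ be an open interval, $b:\Theta\to\mathbb R$ twice differentiable and convex, and $\xi$ a reference measure on $\mathbb R$ such that for every $\theta\in\Theta$ the function $x\mapsto e^{\theta x-b(\theta)}$ is the density with respect to $\xi$ of a probability distribution $\nu_\theta$. Let $J=\dot b(\Theta)$ be the set of means, write $\nu^\mu=\nu_{\dot b^{-1}(\mu)}$ for the member of the family with mean $\mu\in J$, and let $d(\mu,\mu')=\mathrm{KL}(\nu^{\mu},\nu^{\mu'})$. Let $\mu_0^-,\mu_0^+\in J$ and let $\mu_1,\dots,\mu_K\in[\mu_0^-,\mu_0^+]$; put $\mu^*=\max_a\mu_a$. Let the rewards $(Y_{a,s})_{1\le a\le K,\,s\ge1}$ be independent, $Y_{a,s}$ having distribution $\nu^{\mu_a}$. For each arm $a$ let $f_a$ be a probability density on $J$ with respect to the Lebesgue measure with $f_a(u)>0$ for all $u\in J$ (the prior density of the mean of arm $a$), and for $n\ge 0$ and $x\in[\mu_0^-,\mu_0^+]$ let $\pi_{a,n,x}$ be the distribution on $J$ with density $$\pi_{a,n,x}(u)=\frac{\exp\left(n\left[\dot b^{-1}(u)x-b(\dot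 b^{-1}(u))\right]\right)f_a(u)}{\int_J\exp\left(n\left[\dot b^{-1}(w)x-b(\dot b^{-1}(w))\right]\right)f_a(w)\,dw}.$$ For a strategy drawing arm $A_s$ in round $s\ge 1$, let $N_a(t)=\sum_{s=1}^t\mathbf 1_{(A_s=a)}$; the reward received in round $t$ is $Y_{A_t,N_{A_t}(t)}$. Let $\hat\mu_a(t)=\frac1{N_a(t)}\sum_{k=1}^{N_a(t)}Y_{a,k}$ (and $0$ if $N_a(t)=0$), and let $\bar\mu_a(t)=\min(\max(\hat\mu_a(t),\mu_0^-),\mu_0^+)$. Let $c\ge 7$. Consider the regularized Bayes-UCB strategy, which draws each arm once in the first $K$ rounds and, for every $t\ge K$, draws in round $t+1$ an arm $$A_{t+1}\in\operatorname*{argmax}_a\ Q\left(1-\frac{1}{t(\log t)^c};\ \pi_{a,N_a(t),\bar\mu_a(t)}\right),$$ where $Q(\alpha;\pi)$ is the quantile of order $\alpha$ of $\pi$ and ties are broken arbitrarily. (If $K=2$, the order is negative for $t=2$; in that round all indices are considered equal.) Then for every arm $a$ with $\mu_a<\mu^*$ and every $\varepsilon>0$, $$\mathbb E[N_a(T)]\le\frac{1+\varepsilon}{d(\mu_a,\mu^*)}\log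 T+o_\varepsilon(\log T)\qquad(T\to\infty).$$ Consequently $$\limsup_{T\to\infty}\frac{\mathbb E[N_a(T)]}{\log T}\le\frac1{d(\mu_a,\mu^*)},$$ that is, the strategy matches the Lai–Robbins lower bound (it is asymptotically optimal). -/

import Mathlib

open MeasureTheory ProbabilityTheory Filter Topology Asymptotics

noncomputable section

namespace BayesUCB

/-- A one-parameter canonical exponential family on `ℝ`: an open interval `Θ` of natural
parameters, a twice differentiable convex log-partition function `b` and a reference measure `ξ`
such that `x ↦ exp (θ x - b θ)` is a probability density with respect to `ξ` for every `θ ∈ Θ`. -/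
structure ExpFamily where
  /-- the natural parameters -/
  Θ : Set ℝ
  /-- the log-partition function (only its values on `Θ` matter) -/
  b : ℝ → ℝ
  /-- the reference measure -/
  ξ : Measure ℝ
  isOpen_Θ : IsOpen Θ
  ordConnected_Θ : Θ.OrdConnected
  differentiableOn_b : DifferentiableOn ℝ b Θ
  differentiableOn_deriv_b : DifferentiableOn ℝ (deriv b) Θ
  convexOn_b : ConvexOn ℝ Θ b
  isProbabilityMeasure : ∀ θ ∈ Θ,
    IsProbabilityMeasure (ξ.withDensity fun x => ENNReal.ofReal (Real.exp (θ * x - b θ)))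

namespace ExpFamily

variable (F : ExpFamily)

/-- The member `ν_θ` of the family with natural parameter `θ`. -/
def law (θ : ℝ) : Measure ℝ :=
  F.ξ.withDensity fun x => ENNReal.ofReal (Real.exp (θ * x - F.b θ))

/-- The interval of means `J = ḃ(Θ)`. -/
def J : Set ℝ := deriv F.b '' F.Θ

/-- The inverse `ḃ⁻¹ : J → Θ` of the mean map. -/
def natParam (u : ℝ) : ℝ := Function.invFunOn (deriv F.b) F.Θ u

/-- The member `ν^μ` of the family with mean `μ ∈ J`. -/
def meanLaw (u : ℝ) : Measure ℝ := F.law (F.natParam u)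

/-- `d(μ, μ')`, the Kullback–Leibler divergence between the members with means `μ` and `μ'`. -/
def d (u v : ℝ) : ℝ := (InformationTheory.klDiv (F.meanLaw u) (F.meanLaw v)).toReal

/-- The likelihood `exp (n [ḃ⁻¹(u) x - b(ḃ⁻¹(u))])` (up to a factor that does not depend on `u`)
of the mean `u` after `n` observations with empirical mean `x`. -/
def likelihood (n : ℕ) (x u : ℝ) : ℝ :=
  Real.exp (n * (F.natParam u * x - F.b (F.natParam u)))

/-- The posterior distribution `π_{n,x}` on the mean, for the prior density `f` on `J`, after `n`
observations with empirical mean `x`. -/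
def posterior (f : ℝ → ℝ) (n : ℕ) (x : ℝ) : Measure ℝ :=
  (volume.restrict F.J).withDensity fun u =>
    ENNReal.ofReal (F.likelihood n x u * f u / ∫ w in F.J, F.likelihood n x w * f w)

end ExpFamily

/-- The quantile of order `α` of a distribution `π` on `ℝ` (meant for `0 < α < 1`). -/
def quantile (α : ℝ) (π : Measure ℝ) : ℝ := sInf {q : ℝ | α ≤ π.real (Set.Iic q)}

section Bandit

variable {Ω : Type*} {K : ℕ}

/-- `N_a(t)`, the number of draws of arm `a` in the rounds `1, …, t`, where `A s` is the arm drawn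
in round `s`. -/
def draws (A : ℕ → Ω → Fin K) (a : Fin K) (t : ℕ) (ω : Ω) : ℕ :=
  ((Finset.Icc 1 t).filter fun s => A s ω = a).card

/-- The empirical mean of arm `a` after `t` rounds (`0` if the arm has not been drawn); `Y a k` is
the reward of the `(k+1)`-st draw of arm `a`. -/
def empMean (Y : Fin K → ℕ → Ω → ℝ) (A : ℕ → Ω → Fin K) (a : Fin K) (t : ℕ) (ω : Ω) : ℝ :=
  (∑ k ∈ Finset.range (draws A a t ω), Y a k ω) / (draws A a t ω : ℝ)

/-- The empirical mean clipped to `[m, M]`. -/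
def clippedMean (m M : ℝ) (Y : Fin K → ℕ → Ω → ℝ) (A : ℕ → Ω → Fin K) (a : Fin K) (t : ℕ)
    (ω : Ω) : ℝ :=
  min (max (empMean Y A a t ω) m) M

/-- The regularized Bayes-UCB index of arm `a` after `t` rounds: the quantile of order
`1 - 1 / (t (log t)^c)` of the posterior computed at the clipped empirical mean.

For `c ≥ 7` the order lies in `(0, 1)` as soon as `t ≥ 3`. For `t = 2` it is negative and the value
below is a convention, the same for all arms, so that then any arm is a maximizer. -/
def index (F : ExpFamily) (f : Fin K → ℝ → ℝ) (c m M : ℝ) (Y : Fin K → ℕ → Ω → ℝ)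
    (A : ℕ → Ω → Fin K) (a : Fin K) (t : ℕ) (ω : Ω) : ℝ :=
  quantile (1 - 1 / ((t : ℝ) * Real.log t ^ c))
    (F.posterior (f a) (draws A a t ω) (clippedMean m M Y A a t ω))

/-- `A` is a regularized Bayes-UCB strategy on the reward table `Y`: each arm is drawn once in the
first `K` rounds and, for `t ≥ K`, the arm drawn in round `t + 1` maximizes the index; ties may be
broken in any (measurable, possibly randomized) way. -/
structure IsBayesUCB [MeasurableSpace Ω] (F : ExpFamily) (f : Fin K → ℝ → ℝ) (c m M : ℝ)
    (Y : Fin K → ℕ → Ω → ℝ) (A : ℕ → Ω → Fin K) : Prop where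
  measurable : ∀ t, Measurable (A t)
  init : ∀ ω a, draws A a K ω = 1
  select : ∀ ω t, K ≤ t → ∀ a, index F f c m M Y A a t ω ≤ index F f c m M Y A (A (t + 1) ω) t ω

end Bandit

end BayesUCB

end

/-! ### Exponential families: tilting, means, Kullback–Leibler divergence -/

namespace BayesUCB
namespace ExpFamily

variable (F : ExpFamily)

/-! Fix an optimal arm `o`, a suboptimal arm `a`, and write s_t = 1/(t (log t)^c). When `a` is
drawn, its index is at least that of `o`. Hence one of three things holds: the index of `o` lies
below a level p slightly smaller than `μ o`; or the clipped mean of `a` is more than δ away from `μ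
a`; or the posterior of `a`, computed at a mean close to `μ a`, still gives mass more than s_t to
values beyond `μ o - δ`.

In the last case this mass is at most a constant times exp(-n g) after n draws, with g = d(μ_a,
μ_o)/(1+ε) (`posterior_Ioi_le`), so n is at most (log t + c log log t + const)/g: the main term.
Distinct draws of `a` have distinct n (`card_filter_draws_le`), so by Chernoff the second case costs
a convergent geometric series.

In the first case, lower bounds on the posterior mass (`lt_and_le_of_quantile_lt`) force the clipped
mean x of `o` to satisfy x < q and exp(-n d(x,w)) ≤ const · s_t, for points p < q < w < μ_o.
Chernoff bounds the probability of a mean at most x by exp(-n d(x,μ_o)), and `d_add_d_le` splits off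
the factor exp(-n d(x,w)), leaving exp(-n d(w,μ_o)), which is summable in n
(`measureReal_clipped_le`). A union bound over n therefore costs only a constant: round t
contributes O(s_t), and the sum of the s_t is o(log T). -/

theorem law_eq_withDensity_law (θ η : ℝ) :
    F.law η = (F.law θ).withDensity
      fun x => ENNReal.ofReal (Real.exp ((η - θ) * x - F.b η + F.b θ)) := by
  unfold law
  rw [← withDensity_mul _ (by fun_prop) (by fun_prop)]
  congr 1
  ext x
  rw [Pi.mul_apply, ← ENNReal.ofReal_mul (Real.exp_pos _).le, ← Real.exp_add]
  congr 2
  ring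

theorem isProbabilityMeasure_law {θ : ℝ} (hθ : θ ∈ F.Θ) : IsProbabilityMeasure (F.law θ) :=
  F.isProbabilityMeasure θ hθ

theorem law_absolutelyContinuous (θ η : ℝ) : F.law η ≪ F.law θ := by
  rw [F.law_eq_withDensity_law θ η]
  exact withDensity_absolutelyContinuous _ _

theorem lintegral_tilt {θ η : ℝ} (hη : η ∈ F.Θ) :
    ∫⁻ x, ENNReal.ofReal (Real.exp ((η - θ) * x - F.b η + F.b θ)) ∂F.law θ = 1 := by
  have := (F.isProbabilityMeasure_law hη).measure_univ
  rwa [F.law_eq_withDensity_law θ η, withDensity_apply _ MeasurableSet.univ,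
    Measure.restrict_univ] at this

theorem integrable_exp_mul_law {θ t : ℝ} (hη : θ + t ∈ F.Θ) :
    Integrable (fun x => Real.exp (t * x)) (F.law θ) := by
  have h := F.lintegral_tilt (θ := θ) hη
  have hi : Integrable (fun x => Real.exp ((θ + t - θ) * x - F.b (θ + t) + F.b θ)) (F.law θ) := by
    refine ⟨by fun_prop, ?_⟩
    rw [hasFiniteIntegral_iff_ofReal (ae_of_all _ fun x => (Real.exp_pos _).le), h]
    exact ENNReal.one_lt_top
  refine (hi.mul_const (Real.exp (F.b (θ + t) - F.b θ))).congr (ae_of_all _ fun x => ?_)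
  simp only [← Real.exp_add]
  congr 1
  ring

theorem integral_exp_mul_law {θ t : ℝ} (hη : θ + t ∈ F.Θ) :
    ∫ x, Real.exp (t * x) ∂F.law θ = Real.exp (F.b (θ + t) - F.b θ) := by
  have h := F.lintegral_tilt (θ := θ) hη
  have hi : ∫ x, Real.exp ((θ + t - θ) * x - F.b (θ + t) + F.b θ) ∂F.law θ = 1 := by
    rw [integral_eq_lintegral_of_nonneg_ae (ae_of_all _ fun x => (Real.exp_pos _).le)
      (by fun_prop), h, ENNReal.toReal_one]
  have h2 : ∀ x, Real.exp (t * x) = Real.exp (F.b (θ + t) - F.b θ) *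
      Real.exp ((θ + t - θ) * x - F.b (θ + t) + F.b θ) := fun x => by
    rw [← Real.exp_add]
    congr 1
    ring
  simp_rw [h2]
  rw [integral_const_mul, hi, mul_one]

theorem zero_mem_interior_integrableExpSet {θ : ℝ} (hθ : θ ∈ F.Θ) :
    0 ∈ interior (integrableExpSet id (F.law θ)) := by
  rw [mem_interior_iff_mem_nhds]
  have h : ∀ᶠ t in 𝓝 (0 : ℝ), θ + t ∈ F.Θ := by
    have hc : ContinuousAt (fun t : ℝ => θ + t) 0 := by fun_prop
    exact hc.eventually_mem (F.isOpen_Θ.mem_nhds (by simpa using hθ))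
  filter_upwards [h] with t ht
  exact F.integrable_exp_mul_law ht

theorem integrable_id_law {θ : ℝ} (hθ : θ ∈ F.Θ) : Integrable (fun x : ℝ => x) (F.law θ) :=
  integrable_of_mem_interior_integrableExpSet (F.zero_mem_interior_integrableExpSet hθ)

theorem hasDerivAt_b {θ : ℝ} (hθ : θ ∈ F.Θ) : HasDerivAt F.b (deriv F.b θ) θ :=
  (F.differentiableOn_b.differentiableAt (F.isOpen_Θ.mem_nhds hθ)).hasDerivAt

/-- Near 0 the moment generating function is exp(b(θ+t) - b(θ)); its derivative at 0 is the mean. -/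
theorem integral_id_law {θ : ℝ} (hθ : θ ∈ F.Θ) : ∫ x, x ∂F.law θ = deriv F.b θ := by
  have h := deriv_mgf_zero (F.zero_mem_interior_integrableExpSet hθ)
  simp only [id] at h
  rw [← h]
  have he : mgf id (F.law θ) =ᶠ[𝓝 0] fun t => Real.exp (F.b (θ + t) - F.b θ) := by
    have hc : ContinuousAt (fun t : ℝ => θ + t) 0 := by fun_prop
    filter_upwards [hc.eventually_mem (F.isOpen_Θ.mem_nhds (by simpa using hθ))] with t ht
    exact F.integral_exp_mul_law ht
  rw [he.deriv_eq]
  have h1 : HasDerivAt F.b (deriv F.b θ) (θ + 0) := by simpa using F.hasDerivAt_b hθ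
  have h2 := ((h1.comp_const_add θ 0).sub_const (F.b θ)).exp
  simpa using h2.deriv

theorem toReal_klDiv_law {θ η : ℝ} (hθ : θ ∈ F.Θ) (hη : η ∈ F.Θ) :
    (InformationTheory.klDiv (F.law θ) (F.law η)).toReal =
      (θ - η) * deriv F.b θ - F.b θ + F.b η := by
  have := F.isProbabilityMeasure_law hθ
  have := F.isProbabilityMeasure_law hη
  rw [InformationTheory.toReal_klDiv_of_measure_eq (F.law_absolutelyContinuous _ _) (by simp)]
  have h : llr (F.law θ) (F.law η) =ᵐ[F.law θ] fun x => (θ - η) * x - F.b θ + F.b η := by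
    -- The density formula holds almost everywhere for `law η`; absolute continuity transfers it to
    -- `law θ`.
    have h1 := (F.law_absolutelyContinuous η θ).ae_le (Measure.rnDeriv_withDensity (F.law η)
      (f := fun x => ENNReal.ofReal (Real.exp ((θ - η) * x - F.b θ + F.b η))) (by fun_prop))
    rw [← F.law_eq_withDensity_law η θ] at h1
    filter_upwards [h1] with x hx
    rw [llr, hx, ENNReal.toReal_ofReal (Real.exp_pos _).le, Real.log_exp]
  have hi := F.integrable_id_law hθ
  have hi' : Integrable (fun x => (θ - η) * x - F.b θ) (F.law θ) :=
    (hi.const_mul _).sub (integrable_const _)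
  rw [integral_congr_ae h, integral_add hi' (integrable_const _), integral_sub (hi.const_mul _) (integrable_const _), integral_const_mul,
    F.integral_id_law hθ]
  simp

theorem monotoneOn_deriv_b : MonotoneOn (deriv F.b) F.Θ :=
  F.convexOn_b.monotoneOn_deriv fun _ h => (F.hasDerivAt_b h).differentiableAt

/-- The function e^{t(x-p)} + e^{-t(x-p)} - 2 is a perfect square, and the two hypotheses on b make
its mean zero. -/
theorem ae_eq_of_law_exp_eq {θ t p : ℝ} (ht : t ≠ 0) (h1 : θ + t ∈ F.Θ) (h2 : θ - t ∈ F.Θ)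
    (hθ : θ ∈ F.Θ) (e1 : F.b (θ + t) = F.b θ + p * t) (e2 : F.b (θ - t) = F.b θ - p * t) :
    ∀ᵐ x ∂F.law θ, x = p := by
  have := F.isProbabilityMeasure_law hθ
  have i1 := F.integrable_exp_mul_law h1
  have i2 := F.integrable_exp_mul_law (θ := θ) (t := -t) (by simpa [← sub_eq_add_neg] using h2)
  have j1 := F.integral_exp_mul_law h1
  have j2 := F.integral_exp_mul_law (θ := θ) (t := -t) (by simpa [← sub_eq_add_neg] using h2)
  rw [← sub_eq_add_neg, e2] at j2
  rw [e1] at j1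
  have hI : ∫ x, (Real.exp (-p * t) * Real.exp (t * x) + Real.exp (p * t) * Real.exp (-t * x) - 2)
      ∂F.law θ = 0 := by
    have i3 : Integrable (fun x => Real.exp (-p * t) * Real.exp (t * x) +
        Real.exp (p * t) * Real.exp (-t * x)) (F.law θ) := (i1.const_mul _).add (i2.const_mul _)
    rw [integral_sub i3 (integrable_const _), integral_add (i1.const_mul _) (i2.const_mul _), integral_const_mul, integral_const_mul,
      j1, j2, ← Real.exp_add, ← Real.exp_add]
    ring_nf
    simp
  have key : ∀ x, Real.exp (-p * t) * Real.exp (t * x) + Real.exp (p * t) * Real.exp (-t * x) - 2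
      = (Real.exp (t * (x - p) / 2) - Real.exp (-(t * (x - p) / 2))) ^ 2 := fun x => by
    rw [sub_sq, ← Real.exp_nat_mul, ← Real.exp_nat_mul, mul_assoc 2, ← Real.exp_add,
      ← Real.exp_add, ← Real.exp_add, add_neg_cancel, Real.exp_zero]
    push_cast
    ring_nf
  simp_rw [key] at hI
  rw [integral_eq_zero_iff_of_nonneg (fun x => sq_nonneg _)] at hI
  · filter_upwards [hI] with x hx
    have := sub_eq_zero.1 (pow_eq_zero_iff two_ne_zero |>.1 hx)
    have := Real.exp_injective this
    have h3 : t * (x - p) = 0 := by linarith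
    rcases mul_eq_zero.1 h3 with h | h
    · exact absurd h ht
    · linarith
  · have := ((i1.const_mul (Real.exp (-p * t))).add
      (i2.const_mul (Real.exp (p * t)))).sub (integrable_const (2 : ℝ))
    exact this.congr (ae_of_all _ fun x => key x)

/-- A family with two distinct means has an injective mean map. -/
theorem strictMonoOn_deriv_b {u v : ℝ} (hu : u ∈ F.J) (hv : v ∈ F.J) (huv : u ≠ v) :
    StrictMonoOn (deriv F.b) F.Θ := by
  intro α hα β hβ hαβ
  refine lt_of_le_of_ne (F.monotoneOn_deriv_b hα hβ hαβ.le) fun heq => ?_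
  have hI : Set.Icc α β ⊆ F.Θ := F.ordConnected_Θ.out hα hβ
  set p := deriv F.b α
  have hd : ∀ x ∈ Set.Icc α β, deriv F.b x = p := fun x hx =>
    le_antisymm (heq ▸ F.monotoneOn_deriv_b (hI hx) hβ hx.2) (F.monotoneOn_deriv_b hα (hI hx) hx.1)
  have haff : ∀ x ∈ Set.Icc α β, F.b x = F.b α + p * (x - α) := by
    intro x hx
    have := constant_of_has_deriv_right_zero (f := fun x => F.b x - p * (x - α)) (a := α) (b := β)
      (fun y hy => ((F.hasDerivAt_b (hI hy)).continuousAt.continuousWithinAt).sub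
        (by fun_prop)) (fun y hy => by
          have h := (F.hasDerivAt_b (hI (Set.Ico_subset_Icc_self hy))).sub
            (((hasDerivAt_id y).sub_const α).const_mul p)
          rw [hd y (Set.Ico_subset_Icc_self hy)] at h
          simpa using! h.hasDerivWithinAt) x hx
    simp only [sub_self, mul_zero, sub_zero] at this
    linarith
  have hm : (α + β) / 2 ∈ Set.Icc α β := ⟨by linarith, by linarith⟩
  -- Since b is affine on [α, β], the law at the midpoint is a point mass.
  have ha : ∀ᵐ x ∂F.law ((α + β) / 2), x = p := by
    refine F.ae_eq_of_law_exp_eq (t := (β - α) / 2) (by linarith) ?_ ?_ (hI hm) ?_ ?_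
    · convert hβ using 1; ring
    · convert hα using 1; ring
    · rw [haff _ hm, show (α + β) / 2 + (β - α) / 2 = β by ring,
        haff β (Set.right_mem_Icc.2 hαβ.le)]
      ring
    · rw [haff _ hm, show (α + β) / 2 - (β - α) / 2 = α by ring]
      ring
  -- All members are mutually absolutely continuous, so the whole family collapses to this point
  -- mass and has a single mean.
  have hall : ∀ θ ∈ F.Θ, deriv F.b θ = p := by
    intro θ hθ
    have := F.isProbabilityMeasure_law hθ
    have h : ∀ᵐ x ∂F.law θ, x = p := (F.law_absolutelyContinuous _ θ).ae_le ha
    rw [← F.integral_id_law hθ, integral_congr_ae h]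
    simp
  obtain ⟨θ, hθ, rfl⟩ := hu
  obtain ⟨η, hη, rfl⟩ := hv
  exact huv ((hall θ hθ).trans (hall η hη).symm)

/-! ### The inverse mean map: monotonicity and continuity -/

theorem natParam_mem {u : ℝ} (hu : u ∈ F.J) : F.natParam u ∈ F.Θ :=
  Function.invFunOn_mem hu

theorem deriv_b_natParam {u : ℝ} (hu : u ∈ F.J) : deriv F.b (F.natParam u) = u :=
  Function.invFunOn_eq hu

theorem strictMonoOn_natParam : StrictMonoOn F.natParam F.J := by
  intro u hu v hv huv
  by_contra! h
  have := F.monotoneOn_deriv_b (F.natParam_mem hv) (F.natParam_mem hu) h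
  rw [F.deriv_b_natParam hu, F.deriv_b_natParam hv] at this
  linarith

theorem ordConnected_J : F.J.OrdConnected := by
  have : ContinuousOn (deriv F.b) F.Θ := F.differentiableOn_deriv_b.continuousOn
  exact (F.ordConnected_Θ.isPreconnected.image _ this).ordConnected

theorem measurableSet_J : MeasurableSet F.J := F.ordConnected_J.measurableSet

theorem isOpen_J {u v : ℝ} (hu : u ∈ F.J) (hv : v ∈ F.J) (huv : u ≠ v) : IsOpen F.J := by
  have hs := F.strictMonoOn_deriv_b hu hv huv
  rw [isOpen_iff_mem_nhds]
  rintro _ ⟨θ, hθ, rfl⟩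
  obtain ⟨e, he, hb⟩ := Metric.isOpen_iff.1 F.isOpen_Θ θ hθ
  have h1 : θ - e / 2 ∈ F.Θ := hb (by simp [abs_of_pos he]; linarith)
  have h2 : θ + e / 2 ∈ F.Θ := hb (by simp [abs_of_pos he]; linarith)
  refine mem_of_superset (Icc_mem_nhds (hs h1 hθ (by linarith)) (hs hθ h2 (by linarith))) ?_
  exact F.ordConnected_J.out ⟨_, h1, rfl⟩ ⟨_, h2, rfl⟩

theorem continuousAt_natParam {u v w : ℝ} (hu : u ∈ F.J) (hv : v ∈ F.J) (huv : u ≠ v)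
    (hw : w ∈ F.J) : ContinuousAt F.natParam w := by
  refine F.strictMonoOn_natParam.continuousAt_of_image_mem_nhds
    ((F.isOpen_J hu hv huv).mem_nhds hw) ?_
  refine mem_of_superset (F.isOpen_Θ.mem_nhds (F.natParam_mem hw)) fun θ hθ => ?_
  refine ⟨deriv F.b θ, ⟨θ, hθ, rfl⟩, ?_⟩
  -- Injectivity of ḃ makes `natParam` a left inverse too, so its image of `J` contains all of Θ.
  exact (F.strictMonoOn_deriv_b hu hv huv).injOn (F.natParam_mem ⟨θ, hθ, rfl⟩) hθ
    (F.deriv_b_natParam ⟨θ, hθ, rfl⟩)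

/-! ### Log-likelihood and divergence in terms of means -/

/-- The normalized log-likelihood of the mean `u` at the empirical mean `x`. -/
noncomputable def logLik (x u : ℝ) : ℝ := F.natParam u * x - F.b (F.natParam u)

theorem d_eq {u v : ℝ} (hu : u ∈ F.J) (hv : v ∈ F.J) : F.d u v = F.logLik u u - F.logLik u v := by
  rw [d, meanLaw, meanLaw, F.toReal_klDiv_law (F.natParam_mem hu) (F.natParam_mem hv),
    F.deriv_b_natParam hu, logLik, logLik]
  ring

theorem logLik_self_sub_nonneg {u v : ℝ} (hu : u ∈ F.J) (hv : v ∈ F.J) :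
    F.logLik u v ≤ F.logLik u u := by
  have := F.d_eq hu hv
  have h : 0 ≤ F.d u v := ENNReal.toReal_nonneg
  linarith

/-- If d(u,v) = 0, nonnegativity of all divergences from u makes `natParam v` a minimizer of θ ↦
b(θ) - θu; the derivative v - u vanishes there. -/
theorem d_pos {u v : ℝ} (hu : u ∈ F.J) (hv : v ∈ F.J) (huv : u ≠ v) : 0 < F.d u v := by
  rw [F.d_eq hu hv]
  refine lt_of_le_of_ne (sub_nonneg.2 (F.logLik_self_sub_nonneg hu hv)) fun h => huv ?_
  have hmem := F.natParam_mem hv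
  have hmin : IsLocalMin (fun θ => F.b θ - θ * u) (F.natParam v) := by
    filter_upwards [F.isOpen_Θ.mem_nhds hmem] with θ hθ
    have h1 := F.toReal_klDiv_law (F.natParam_mem hu) hθ
    have h2 : 0 ≤ (InformationTheory.klDiv (F.law (F.natParam u)) (F.law θ)).toReal :=
      ENNReal.toReal_nonneg
    rw [h1, F.deriv_b_natParam hu] at h2
    simp only [logLik] at h
    linarith
  have hd := (F.hasDerivAt_b hmem).sub ((hasDerivAt_id (F.natParam v)).mul_const u)
  have h0 := hmin.hasDerivAt_eq_zero hd
  rw [F.deriv_b_natParam hv] at h0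
  linarith

/-- Unimodality: `logLik v` is maximal at v, and passing from observation v to x ≥ v adds (x - v)
times the increasing function `natParam`. -/
theorem logLik_le_of_le {x u v : ℝ} (hu : u ∈ F.J) (hv : v ∈ F.J) (huv : u ≤ v) (hx : v ≤ x) :
    F.logLik x u ≤ F.logLik x v := by
  have h := F.logLik_self_sub_nonneg hv hu
  have h1 := F.strictMonoOn_natParam.monotoneOn hu hv huv
  unfold logLik at *
  nlinarith

theorem logLik_le_of_ge {x u v : ℝ} (hu : u ∈ F.J) (hv : v ∈ F.J) (huv : u ≤ v) (hx : x ≤ u) :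
    F.logLik x v ≤ F.logLik x u := by
  have h := F.logLik_self_sub_nonneg hu hv
  have h1 := F.strictMonoOn_natParam.monotoneOn hu hv huv
  unfold logLik at *
  nlinarith

theorem likelihood_eq (n : ℕ) (x u : ℝ) : F.likelihood n x u = Real.exp (n * F.logLik x u) := rfl

theorem likelihood_pos (n : ℕ) (x u : ℝ) : 0 < F.likelihood n x u := Real.exp_pos _

theorem likelihood_le (n : ℕ) {x u v : ℝ} (h : F.logLik x u ≤ F.logLik x v) :
    F.likelihood n x u ≤ F.likelihood n x v := by
  rw [likelihood_eq, likelihood_eq]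
  gcongr

theorem continuousAt_b_natParam {u v w : ℝ} (hu : u ∈ F.J) (hv : v ∈ F.J) (huv : u ≠ v)
    (hw : w ∈ F.J) : ContinuousAt (fun w => F.b (F.natParam w)) w :=
  ContinuousAt.comp (f := F.natParam) (g := F.b)
    (F.hasDerivAt_b (F.natParam_mem hw)).continuousAt (F.continuousAt_natParam hu hv huv hw)

theorem continuousAt_logLik {u v x w : ℝ} (hu : u ∈ F.J) (hv : v ∈ F.J) (huv : u ≠ v)
    (hw : w ∈ F.J) : ContinuousAt (fun p : ℝ × ℝ => F.logLik p.1 p.2) (x, w) := by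
  have h1 : ContinuousAt (fun p : ℝ × ℝ => F.natParam p.2) (x, w) :=
    ContinuousAt.comp (f := fun p : ℝ × ℝ => p.2) (F.continuousAt_natParam hu hv huv hw)
      continuousAt_snd
  have h2 : ContinuousAt (fun p : ℝ × ℝ => F.b (F.natParam p.2)) (x, w) :=
    ContinuousAt.comp (f := fun p : ℝ × ℝ => p.2) (g := fun w => F.b (F.natParam w))
      (F.continuousAt_b_natParam hu hv huv hw) continuousAt_snd
  exact (h1.mul continuousAt_fst).sub h2

end ExpFamily
end BayesUCB

/-! ### Quantiles and tail masses -/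

namespace BayesUCB
section Quantile

variable (π : Measure ℝ) [IsProbabilityMeasure π] {α v w : ℝ}

theorem measureReal_Ici_le_of_quantile_lt (hα : α < 1) (h : quantile α π < v) :
    π.real (Set.Ici v) ≤ 1 - α := by
  -- Nonemptiness, from the limit 1 of the cdf, excludes the default value of `sInf`.
  have hne : {q : ℝ | α ≤ π.real (Set.Iic q)}.Nonempty := by
    obtain ⟨q, hq⟩ := ((tendsto_cdf_atTop π).eventually_const_lt hα).exists
    exact ⟨q, by rw [cdf_eq_real] at hq; exact hq.le⟩
  obtain ⟨q, hq, hqv⟩ := exists_lt_of_csInf_lt hne h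
  have h1 : π.real (Set.Ici v) ≤ π.real (Set.Iic q)ᶜ :=
    measureReal_mono fun x hx => by simpa using hqv.trans_le hx
  rw [probReal_compl_eq_one_sub measurableSet_Iic] at h1
  exact h1.trans (sub_le_sub_left hq 1)

theorem lt_measureReal_Ioi_of_le_quantile (hα : 0 < α) (hwv : w < v) (h : v ≤ quantile α π) :
    1 - α < π.real (Set.Ioi w) := by
  have hb : BddBelow {q : ℝ | α ≤ π.real (Set.Iic q)} := by
    obtain ⟨q, hq⟩ := ((tendsto_cdf_atBot π).eventually_lt_const hα).exists
    refine ⟨q, fun r hr => ?_⟩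
    by_contra! hlt
    rw [cdf_eq_real] at hq
    have : π.real (Set.Iic r) ≤ π.real (Set.Iic q) :=
      measureReal_mono (Set.Iic_subset_Iic.2 hlt.le)
    exact absurd (hr.trans this) (not_le.2 hq)
  have hw : ¬ α ≤ π.real (Set.Iic w) := fun hw => by
    have : quantile α π ≤ w := csInf_le hb hw
    linarith
  rw [← Set.compl_Iic, probReal_compl_eq_one_sub measurableSet_Iic]
  linarith

end Quantile

/-! ### Posterior mass of half-lines -/

namespace ExpFamily

variable {F : ExpFamily}

theorem continuousOn_likelihood (hJ : F.J.Nontrivial) (n : ℕ) (x : ℝ) :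
    ContinuousOn (F.likelihood n x) F.J := by
  obtain ⟨u, hu, v, hv, huv⟩ := hJ
  intro w hw
  refine ContinuousAt.continuousWithinAt ?_
  have h1 := F.continuousAt_natParam hu hv huv hw
  have h2 := F.continuousAt_b_natParam hu hv huv hw
  exact (((h1.mul_const x).sub h2).const_mul (n : ℝ)).rexp

theorem likelihood_le_self {x u : ℝ} (hx : x ∈ F.J) (hu : u ∈ F.J) (n : ℕ) :
    F.likelihood n x u ≤ F.likelihood n x x :=
  F.likelihood_le n (F.logLik_self_sub_nonneg hx hu)

variable {f : ℝ → ℝ} {x : ℝ} {S I : Set ℝ}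

theorem integrableOn_likelihood_mul (hJ : F.J.Nontrivial) (hf : IntegrableOn f F.J)
    (hx : x ∈ F.J) (n : ℕ) : IntegrableOn (fun u => F.likelihood n x u * f u) F.J := by
  refine hf.bdd_mul (c := F.likelihood n x x)
    ((continuousOn_likelihood hJ n x).aestronglyMeasurable F.measurableSet_J) ?_
  filter_upwards [ae_restrict_mem F.measurableSet_J] with u hu
  rw [Real.norm_of_nonneg (F.likelihood_pos n x u).le]
  exact likelihood_le_self hx hu n

theorem mul_setIntegral_le_setIntegral_likelihood (hJ : F.J.Nontrivial)
    (hf : IntegrableOn f F.J) (hpos : ∀ u ∈ F.J, 0 < f u) (hx : x ∈ F.J) (n : ℕ)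
    (hS : MeasurableSet S) (hI : MeasurableSet I) (hIS : I ⊆ S ∩ F.J) {c : ℝ}
    (hc : ∀ u ∈ I, c ≤ F.likelihood n x u) :
    c * ∫ u in I, f u ≤ ∫ u in S ∩ F.J, F.likelihood n x u * f u := by
  have hint := integrableOn_likelihood_mul hJ hf hx n
  have hIJ : I ⊆ F.J := hIS.trans Set.inter_subset_right
  calc c * ∫ u in I, f u = ∫ u in I, c * f u := (integral_const_mul _ _).symm
    _ ≤ ∫ u in I, F.likelihood n x u * f u := by
      refine setIntegral_mono_on ((hf.mono_set hIJ).const_mul c) (hint.mono_set hIJ) hI ?_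
      intro u hu
      exact mul_le_mul_of_nonneg_right (hc u hu) (hpos u (hIJ hu)).le
    _ ≤ _ := by
      refine setIntegral_mono_set (hint.mono_set Set.inter_subset_right) ?_ hIS.eventuallyLE
      filter_upwards [ae_restrict_mem (hS.inter F.measurableSet_J)] with u hu
      exact (mul_pos (F.likelihood_pos n x u) (hpos u hu.2)).le

theorem setIntegral_likelihood_le (hJ : F.J.Nontrivial) (hf : IntegrableOn f F.J)
    (hone : ∫ u in F.J, f u = 1) (hpos : ∀ u ∈ F.J, 0 < f u) (hx : x ∈ F.J) (n : ℕ)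
    (hS : MeasurableSet S) {c : ℝ} (hc0 : 0 ≤ c)
    (hc : ∀ u ∈ S ∩ F.J, F.likelihood n x u ≤ c) :
    ∫ u in S ∩ F.J, F.likelihood n x u * f u ≤ c := by
  have hint := integrableOn_likelihood_mul hJ hf hx n
  have hSJ : S ∩ F.J ⊆ F.J := Set.inter_subset_right
  calc ∫ u in S ∩ F.J, F.likelihood n x u * f u ≤ ∫ u in S ∩ F.J, c * f u := by
        refine setIntegral_mono_on (hint.mono_set hSJ) ((hf.mono_set hSJ).const_mul c)
          (hS.inter F.measurableSet_J) ?_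
        intro u hu
        exact mul_le_mul_of_nonneg_right (hc u hu) (hpos u hu.2).le
    _ = c * ∫ u in S ∩ F.J, f u := integral_const_mul _ _
    _ ≤ c * ∫ u in F.J, f u := by
        refine mul_le_mul_of_nonneg_left (setIntegral_mono_set hf ?_ hSJ.eventuallyLE) hc0
        filter_upwards [ae_restrict_mem F.measurableSet_J] with u hu
        exact (hpos u hu).le
    _ = c := by rw [hone, mul_one]

theorem setIntegral_Icc_pos (hf : IntegrableOn f F.J) (hpos : ∀ u ∈ F.J, 0 < f u) {p q : ℝ}
    (hpq : p < q) (hI : Set.Icc p q ⊆ F.J) : 0 < ∫ u in Set.Icc p q, f u := by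
  refine (setIntegral_pos_iff_support_of_nonneg_ae ?_ (hf.mono_set hI)).2 ?_
  · filter_upwards [ae_restrict_mem measurableSet_Icc] with u hu
    exact (hpos u (hI hu)).le
  · have h : Set.Icc p q ⊆ Function.support f := fun u hu => (hpos u (hI hu)).ne'
    rw [Set.inter_eq_right.2 h]
    simp [hpq]

theorem setIntegral_le_one (hf : IntegrableOn f F.J) (hone : ∫ u in F.J, f u = 1)
    (hpos : ∀ u ∈ F.J, 0 < f u) (hI : I ⊆ F.J) : ∫ u in I, f u ≤ 1 := by
  rw [← hone]
  refine setIntegral_mono_set hf ?_ hI.eventuallyLE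
  filter_upwards [ae_restrict_mem F.measurableSet_J] with u hu
  exact (hpos u hu).le

theorem setIntegral_likelihood_pos (hJ : F.J.Nontrivial) (hf : IntegrableOn f F.J)
    (hpos : ∀ u ∈ F.J, 0 < f u) (hx : x ∈ F.J) (n : ℕ) :
    0 < ∫ u in F.J, F.likelihood n x u * f u := by
  obtain ⟨u, hu, v, hv, huv⟩ := hJ.exists_lt
  have hI : Set.Icc u v ⊆ F.J := F.ordConnected_J.out hu hv
  exact (setIntegral_Icc_pos (integrableOn_likelihood_mul hJ hf hx n)
    (fun w hw => mul_pos (F.likelihood_pos n x w) (hpos w hw)) huv hI).trans_le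
    (setIntegral_mono_set (integrableOn_likelihood_mul hJ hf hx n) (by
      filter_upwards [ae_restrict_mem F.measurableSet_J] with w hw
      exact (mul_pos (F.likelihood_pos n x w) (hpos w hw)).le) hI.eventuallyLE)

theorem posterior_apply (hJ : F.J.Nontrivial) (hf : IntegrableOn f F.J)
    (hpos : ∀ u ∈ F.J, 0 < f u) (hx : x ∈ F.J) (n : ℕ) (hS : MeasurableSet S) :
    F.posterior f n x S = ENNReal.ofReal ((∫ u in S ∩ F.J, F.likelihood n x u * f u) /
      ∫ u in F.J, F.likelihood n x u * f u) := by
  rw [posterior, withDensity_apply _ hS, Measure.restrict_restrict hS, ← integral_div,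
    ofReal_integral_eq_lintegral_ofReal]
  · exact ((integrableOn_likelihood_mul hJ hf hx n).mono_set Set.inter_subset_right).div_const _
  · filter_upwards [ae_restrict_mem (hS.inter F.measurableSet_J)] with u hu
    exact div_nonneg (mul_pos (F.likelihood_pos n x u) (hpos u hu.2)).le
      (setIntegral_likelihood_pos hJ hf hpos hx n).le

theorem isProbabilityMeasure_posterior (hJ : F.J.Nontrivial) (hf : IntegrableOn f F.J)
    (hpos : ∀ u ∈ F.J, 0 < f u) (hx : x ∈ F.J) (n : ℕ) :
    IsProbabilityMeasure (F.posterior f n x) := by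
  constructor
  rw [posterior_apply hJ hf hpos hx n MeasurableSet.univ, Set.univ_inter,
    div_self (setIntegral_likelihood_pos hJ hf hpos hx n).ne', ENNReal.ofReal_one]

theorem posterior_real (hJ : F.J.Nontrivial) (hf : IntegrableOn f F.J)
    (hpos : ∀ u ∈ F.J, 0 < f u) (hx : x ∈ F.J) (n : ℕ) (hS : MeasurableSet S) :
    (F.posterior f n x).real S = (∫ u in S ∩ F.J, F.likelihood n x u * f u) /
      ∫ u in F.J, F.likelihood n x u * f u := by
  rw [measureReal_def, posterior_apply hJ hf hpos hx n hS, ENNReal.toReal_ofReal]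
  refine div_nonneg (setIntegral_nonneg (hS.inter F.measurableSet_J) fun u hu => ?_)
    (setIntegral_likelihood_pos hJ hf hpos hx n).le
  exact (mul_pos (F.likelihood_pos n x u) (hpos u hu.2)).le

/-- If the empirical mean is at least `q > p`, the posterior mass above `p` is bounded below,
uniformly in the number of observations. -/
theorem le_posterior_Ici_of_le (hJ : F.J.Nontrivial) (hf : IntegrableOn f F.J)
    (hone : ∫ u in F.J, f u = 1) (hpos : ∀ u ∈ F.J, 0 < f u) (hx : x ∈ F.J) (n : ℕ) {p q : ℝ}
    (hI : Set.Icc p q ⊆ F.J) (hpq : p < q) (hqx : q ≤ x) :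
    (∫ u in Set.Icc p q, f u) / 2 ≤ (F.posterior f n x).real (Set.Ici p) := by
  have hp : p ∈ F.J := hI (Set.left_mem_Icc.2 hpq.le)
  have hm := setIntegral_Icc_pos hf hpos hpq hI
  have hm1 := setIntegral_le_one hf hone hpos hI
  have hD := setIntegral_likelihood_pos hJ hf hpos hx n
  have hint := integrableOn_likelihood_mul hJ hf hx n
  rw [posterior_real hJ hf hpos hx n measurableSet_Ici, le_div_iff₀ hD]
  -- The likelihood at p bounds the likelihood from below on [p,q] and from above left of p. With m
  -- the prior mass of [p,q], the posterior odds of [p,∞) are at least m, and m/(1+m) ≥ m/2 because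
  -- m ≤ 1.
  have h1 := mul_setIntegral_le_setIntegral_likelihood hJ hf hpos hx n
    (S := Set.Ici p) (I := Set.Icc p q) measurableSet_Ici measurableSet_Icc
    (fun u hu => ⟨hu.1, hI hu⟩) (c := F.likelihood n x p)
    (fun u hu => F.likelihood_le n (F.logLik_le_of_le hp (hI hu) hu.1 (hu.2.trans hqx)))
  have h2 := setIntegral_likelihood_le hJ hf hone hpos hx n (S := (Set.Ici p)ᶜ)
    measurableSet_Ici.compl (F.likelihood_pos n x p).le (fun u hu =>
      F.likelihood_le n (F.logLik_le_of_le hu.2 hp (by simpa using (le_of_lt (by simpa using hu.1)))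
        (hpq.le.trans hqx)))
  have h3 := setIntegral_union (f := fun u => F.likelihood n x u * f u) (μ := volume)
    (s := Set.Ici p ∩ F.J) (t := (Set.Ici p)ᶜ ∩ F.J)
    ((disjoint_compl_right).mono Set.inter_subset_left Set.inter_subset_left)
    (measurableSet_Ici.compl.inter F.measurableSet_J)
    (hint.mono_set Set.inter_subset_right) (hint.mono_set Set.inter_subset_right)
  rw [← Set.union_inter_distrib_right, Set.union_compl_self, Set.univ_inter] at h3
  rw [h3]
  have hL := F.likelihood_pos n x p
  have h4 := mul_le_mul_of_nonneg_right hm1 ((mul_pos hL hm).le.trans h1)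
  have h5 := mul_le_mul_of_nonneg_left h2 hm.le
  linarith

/-- If the empirical mean is at most `q < r`, the posterior mass above `q` is at least
`exp (-n d(x, r))` up to a constant. -/
theorem le_posterior_Ici_of_ge (hJ : F.J.Nontrivial) (hf : IntegrableOn f F.J)
    (hone : ∫ u in F.J, f u = 1) (hpos : ∀ u ∈ F.J, 0 < f u) (hx : x ∈ F.J) (n : ℕ) {p q r : ℝ}
    (hI : Set.Icc q r ⊆ F.J) (hpq : p ≤ q) (hqr : q < r) (hxq : x ≤ q) :
    (∫ u in Set.Icc q r, f u) * Real.exp (-(n * F.d x r)) ≤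
      (F.posterior f n x).real (Set.Ici p) := by
  have hr : r ∈ F.J := hI (Set.right_mem_Icc.2 hqr.le)
  have hm := setIntegral_Icc_pos hf hpos hqr hI
  have hD := setIntegral_likelihood_pos hJ hf hpos hx n
  rw [posterior_real hJ hf hpos hx n measurableSet_Ici, le_div_iff₀ hD]
  -- On [q,r] the likelihood is smallest at r; the normalizing integral is at most the maximal
  -- likelihood, attained at x. Their ratio is exp(-n d(x,r)).
  have h1 := mul_setIntegral_le_setIntegral_likelihood hJ hf hpos hx n
    (S := Set.Ici p) (I := Set.Icc q r) measurableSet_Ici measurableSet_Icc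
    (fun u hu => ⟨hpq.trans hu.1, hI hu⟩) (c := F.likelihood n x r)
    (fun u hu => F.likelihood_le n (F.logLik_le_of_ge (hI hu) hr hu.2 (hxq.trans hu.1)))
  have h2 := setIntegral_likelihood_le hJ hf hone hpos hx n (S := Set.univ)
    MeasurableSet.univ (F.likelihood_pos n x x).le (fun u hu => likelihood_le_self hx hu.2 n)
  rw [Set.univ_inter] at h2
  refine le_trans ?_ h1
  calc _ ≤ (∫ u in Set.Icc q r, f u) * Real.exp (-(n * F.d x r)) * F.likelihood n x x := by gcongr
    _ = _ := by
      rw [F.d_eq hx hr, F.likelihood_eq, F.likelihood_eq, mul_assoc, ← Real.exp_add, mul_comm]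
      congr 2
      ring

/-- Beyond v ≥ x the likelihood is at most its value at v, while the normalizing integral is at
least the contribution of [p,q], where the likelihood is larger by a factor exp(n g). -/
theorem posterior_Ioi_le (hJ : F.J.Nontrivial) (hf : IntegrableOn f F.J)
    (hone : ∫ u in F.J, f u = 1) (hpos : ∀ u ∈ F.J, 0 < f u) (hx : x ∈ F.J) (n : ℕ) {p q v g : ℝ}
    (hI : Set.Icc p q ⊆ F.J) (hpq : p < q) (hv : v ∈ F.J) (hxv : x ≤ v)
    (hg : ∀ w ∈ Set.Icc p q, g ≤ F.logLik x w - F.logLik x v) :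
    (F.posterior f n x).real (Set.Ioi v) ≤ Real.exp (-(n * g)) / ∫ u in Set.Icc p q, f u := by
  have hm := setIntegral_Icc_pos hf hpos hpq hI
  have hD := setIntegral_likelihood_pos hJ hf hpos hx n
  rw [posterior_real hJ hf hpos hx n measurableSet_Ioi, div_le_div_iff₀ hD hm]
  have h1 := mul_setIntegral_le_setIntegral_likelihood hJ hf hpos hx n
    (S := Set.univ) (I := Set.Icc p q) MeasurableSet.univ measurableSet_Icc
    (fun u hu => ⟨trivial, hI hu⟩) (c := Real.exp (n * (g + F.logLik x v)))
    (fun u hu => by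
      rw [F.likelihood_eq]
      have := hg u hu
      gcongr
      linarith)
  have h2 := setIntegral_likelihood_le hJ hf hone hpos hx n (S := Set.Ioi v)
    measurableSet_Ioi (F.likelihood_pos n x v).le (fun u hu =>
      F.likelihood_le n (F.logLik_le_of_ge hv hu.2 (le_of_lt hu.1) hxv))
  rw [Set.univ_inter] at h1
  calc _ ≤ F.likelihood n x v * ∫ u in Set.Icc p q, f u := by gcongr
    _ = Real.exp (-(n * g)) * (Real.exp (n * (g + F.logLik x v)) * ∫ u in Set.Icc p q, f u) := by
      rw [F.likelihood_eq, ← mul_assoc, ← Real.exp_add]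
      congr 2
      ring
    _ ≤ _ := by gcongr

end ExpFamily
end BayesUCB

/-! ### Chernoff bounds for empirical and clipped means -/

namespace BayesUCB
namespace ExpFamily

variable {F : ExpFamily} {Ω : Type*} [MeasurableSpace Ω] {P : Measure Ω}
  {X : ℕ → Ω → ℝ} {u y : ℝ}

theorem mgf_of_hasLaw {Z : Ω → ℝ} (hZ : HasLaw Z (F.meanLaw u) P) (hy : y ∈ F.J) :
    mgf Z P (F.natParam y - F.natParam u) =
      Real.exp (F.b (F.natParam y) - F.b (F.natParam u)) := by
  have h := F.integral_exp_mul_law (θ := F.natParam u) (t := F.natParam y - F.natParam u)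
    (by simpa using F.natParam_mem hy)
  rw [add_sub_cancel] at h
  rw [← mgf_id_map hZ.aemeasurable, hZ.map_eq, ← h]
  rfl

/-- Tilting from mean u to mean y is the optimal Chernoff exponent at level y: it yields the rate
d(y,u) exactly. -/
theorem exp_mul_mgf_sum (hX : ∀ k, HasLaw (X k) (F.meanLaw u) P) (hind : iIndepFun X P)
    (hu : u ∈ F.J) (hy : y ∈ F.J) (n : ℕ) :
    Real.exp (-(F.natParam y - F.natParam u) * (n * y)) *
      mgf (∑ k ∈ Finset.range n, X k) P (F.natParam y - F.natParam u) =
      Real.exp (-(n * F.d y u)) := by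
  rw [hind.mgf_sum₀ (fun k => (hX k).aemeasurable),
    Finset.prod_congr rfl fun k _ => mgf_of_hasLaw (hX k) hy, Finset.prod_const,
    Finset.card_range, ← Real.exp_nat_mul, ← Real.exp_add, F.d_eq hy hu, logLik, logLik]
  congr 1
  ring

theorem integrable_exp_mul_sum (hX : ∀ k, HasLaw (X k) (F.meanLaw u) P) (hind : iIndepFun X P)
    (hu : u ∈ F.J) (hy : y ∈ F.J) (n : ℕ) :
    Integrable (fun ω => Real.exp ((F.natParam y - F.natParam u) *
      (∑ k ∈ Finset.range n, X k) ω)) P := by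
  -- A non-integrable exponential would give `mgf` the default value 0, but the product in
  -- `exp_mul_mgf_sum` is positive.
  by_contra h
  have h1 := exp_mul_mgf_sum hX hind hu hy n
  rw [mgf_undef h, mul_zero] at h1
  exact (Real.exp_pos _).ne h1

variable [IsProbabilityMeasure P]

theorem measureReal_mean_le_le (hX : ∀ k, HasLaw (X k) (F.meanLaw u) P) (hind : iIndepFun X P)
    (hu : u ∈ F.J) (hy : y ∈ F.J) (hyu : y ≤ u) (n : ℕ) :
    P.real {ω | (∑ k ∈ Finset.range n, X k ω) / (n : ℝ) ≤ y} ≤ Real.exp (-(n * F.d y u)) := by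
  rcases n.eq_zero_or_pos with rfl | hn
  · simp
  have hn' : (0 : ℝ) < n := by exact_mod_cast hn
  rw [← exp_mul_mgf_sum hX hind hu hy n]
  refine le_trans (measureReal_mono fun ω hω => ?_) (measure_le_le_exp_mul_mgf _
    (sub_nonpos.2 (F.strictMonoOn_natParam.monotoneOn hy hu hyu))
    (integrable_exp_mul_sum hX hind hu hy n))
  simp only [Set.mem_ofPred_eq, div_le_iff₀ hn', Finset.sum_apply] at hω ⊢
  linarith

theorem measureReal_le_mean_le (hX : ∀ k, HasLaw (X k) (F.meanLaw u) P) (hind : iIndepFun X P)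
    (hu : u ∈ F.J) (hy : y ∈ F.J) (hyu : u ≤ y) (n : ℕ) :
    P.real {ω | y ≤ (∑ k ∈ Finset.range n, X k ω) / (n : ℝ)} ≤ Real.exp (-(n * F.d y u)) := by
  rcases n.eq_zero_or_pos with rfl | hn
  · simp
  have hn' : (0 : ℝ) < n := by exact_mod_cast hn
  rw [← exp_mul_mgf_sum hX hind hu hy n]
  refine le_trans (measureReal_mono fun ω hω => ?_) (measure_ge_le_exp_mul_mgf _
    (sub_nonneg.2 (F.strictMonoOn_natParam.monotoneOn hu hy hyu))
    (integrable_exp_mul_sum hX hind hu hy n))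
  simp only [Set.mem_ofPred_eq, le_div_iff₀ hn', Finset.sum_apply] at hω ⊢
  linarith

/-- The difference of the two sides is (`natParam u` - `natParam v`)(v - y) ≥ 0. -/
theorem d_add_d_le {y v u : ℝ} (hy : y ∈ F.J) (hv : v ∈ F.J) (hu : u ∈ F.J) (hyv : y ≤ v)
    (hvu : v ≤ u) : F.d y v + F.d v u ≤ F.d y u := by
  have h := F.strictMonoOn_natParam.monotoneOn hv hu hvu
  rw [F.d_eq hy hv, F.d_eq hv hu, F.d_eq hy hu]
  unfold logLik
  nlinarith

theorem continuousOn_d_left (hJ : F.J.Nontrivial) {v : ℝ} (hv : v ∈ F.J) :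
    ContinuousOn (fun z => F.d z v) F.J := by
  obtain ⟨p, hp, q, hq, hpq⟩ := hJ
  have h : ContinuousOn (fun z => F.logLik z z - F.logLik z v) F.J := by
    intro z hz
    refine ContinuousAt.continuousWithinAt ?_
    have h1 := F.continuousAt_natParam hp hq hpq hz
    have h2 := F.continuousAt_b_natParam hp hq hpq hz
    exact ((h1.mul continuousAt_id).sub h2).sub ((continuousAt_id.const_mul _).sub_const _)
  exact h.congr fun z hz => F.d_eq hz hv

/-- Chernoff bound for the event that the clipped mean is so small that the posterior mass near
`u` may fall below the level `s`. -/
theorem measureReal_clipped_le (hJ : F.J.Nontrivial) (hX : ∀ k, HasLaw (X k) (F.meanLaw u) P)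
    (hind : iIndepFun X P) {m M v w c s : ℝ} (hm : m ∈ F.J) (hM : M ∈ F.J) (hu : u ∈ F.J)
    (hvw : v < w) (hw : w ∈ F.J) (hwu : w < u) (huM : u ≤ M) (hc : 0 < c) (hs : 0 ≤ s)
    (n : ℕ) :
    P.real {ω | min (max ((∑ k ∈ Finset.range n, X k ω) / (n : ℝ)) m) M < v ∧
      c * Real.exp (-(n * F.d (min (max ((∑ k ∈ Finset.range n, X k ω) / (n : ℝ)) m) M) w)) ≤ s}
      ≤ Real.exp (-(n * F.d w u)) * (s / c) := by
  set Z : Set ℝ := Set.Icc m v ∩ {z | c * Real.exp (-(n * F.d z w)) ≤ s} with hZ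
  have hsub : ∀ ω, (min (max ((∑ k ∈ Finset.range n, X k ω) / (n : ℝ)) m) M < v ∧
      c * Real.exp (-(n * F.d (min (max ((∑ k ∈ Finset.range n, X k ω) / (n : ℝ)) m) M) w)) ≤ s) →
      min (max ((∑ k ∈ Finset.range n, X k ω) / (n : ℝ)) m) M ∈ Z := by
    rintro ω ⟨h1, h2⟩
    refine ⟨⟨le_min (le_max_right _ _) ?_, h1.le⟩, h2⟩
    by_contra! hMm
    rw [min_eq_right (hMm.le.trans (le_max_right _ _))] at h1
    linarith
  rcases Z.eq_empty_or_nonempty with he | hne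
  · have : {ω | min (max ((∑ k ∈ Finset.range n, X k ω) / (n : ℝ)) m) M < v ∧
      c * Real.exp (-(n * F.d (min (max ((∑ k ∈ Finset.range n, X k ω) / (n : ℝ)) m) M) w)) ≤ s}
      = ∅ := Set.eq_empty_of_forall_notMem fun ω hω => by
        have := hsub ω hω
        rw [he] at this
        exact this
    rw [this, measureReal_empty]
    positivity
  have hvJ : Set.Icc m v ⊆ F.J :=
    (Set.Icc_subset_Icc_right (by linarith)).trans (F.ordConnected_J.out hm hM)
  have hcont : ContinuousOn (fun z => c * Real.exp (-(n * F.d z w))) (Set.Icc m v) :=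
    ((((continuousOn_d_left hJ hw).mono hvJ).const_mul (n : ℝ)).neg.rexp).const_mul c
  have hcl : IsClosed Z := hcont.preimage_isClosed_of_isClosed isClosed_Icc isClosed_Iic
  have hcomp : IsCompact Z := isCompact_Icc.of_isClosed_subset hcl Set.inter_subset_left
  -- The largest bad value y turns the event into a single lower deviation, and y itself still
  -- satisfies the constraint defining `Z`.
  obtain ⟨y, hyZ, hmax⟩ := hcomp.exists_isGreatest hne
  have hyJ := hvJ hyZ.1
  have hyv : y ≤ v := hyZ.1.2
  calc _ ≤ P.real {ω | (∑ k ∈ Finset.range n, X k ω) / (n : ℝ) ≤ y} := by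
        refine measureReal_mono fun ω hω => ?_
        have h := hmax (hsub ω hω)
        -- Clipping at M plays no role, as y ≤ v < w < u ≤ M.
        rcases min_le_iff.1 h with h | h
        · exact (le_max_left _ _).trans h
        · linarith
    _ ≤ Real.exp (-(n * F.d y u)) := measureReal_mean_le_le hX hind hu hyJ (by linarith) n
    _ ≤ Real.exp (-(n * F.d w u)) * Real.exp (-(n * F.d y w)) := by
        rw [← Real.exp_add]
        have := mul_le_mul_of_nonneg_left (d_add_d_le hyJ hw hu (by linarith) hwu.le)
          (Nat.cast_nonneg (α := ℝ) n)
        gcongr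
        linarith
    _ ≤ _ := by
        gcongr
        rw [le_div_iff₀ hc, mul_comm]
        exact hyZ.2

/-- Clipping is 1-Lipschitz and fixes p. -/
theorem abs_clip_sub_le {x p m M : ℝ} (hp : p ∈ Set.Icc m M) : |min (max x m) M - p| ≤ |x - p| := by
  have h := abs_min_sub_min_le_max (max x m) M (max p m) M
  have h' := abs_max_sub_max_le_max x m p m
  simp only [sub_self, abs_zero, abs_nonneg, max_eq_left] at h h'
  rw [max_eq_left hp.1, min_eq_left hp.2] at h
  rw [max_eq_left hp.1] at h'
  exact h.trans h'

theorem measureReal_abs_clipped_sub_le (hX : ∀ k, HasLaw (X k) (F.meanLaw u) P)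
    (hind : iIndepFun X P) {m M δ : ℝ} (hu : u ∈ F.J) (huI : u ∈ Set.Icc m M) (hδ : 0 ≤ δ)
    (h1 : u - δ ∈ F.J) (h2 : u + δ ∈ F.J) (n : ℕ) :
    P.real {ω | δ < |min (max ((∑ k ∈ Finset.range n, X k ω) / (n : ℝ)) m) M - u|} ≤
      Real.exp (-(n * F.d (u - δ) u)) + Real.exp (-(n * F.d (u + δ) u)) := by
  refine le_trans (measureReal_mono (s₂ := {ω | (∑ k ∈ Finset.range n, X k ω) / (n : ℝ) ≤ u - δ} ∪
    {ω | u + δ ≤ (∑ k ∈ Finset.range n, X k ω) / (n : ℝ)}) fun ω hω => ?_)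
    ((measureReal_union_le _ _).trans (add_le_add
      (measureReal_mean_le_le hX hind hu h1 (by linarith) n)
      (measureReal_le_mean_le hX hind hu h2 (by linarith) n)))
  have h := lt_of_lt_of_le hω (abs_clip_sub_le huI)
  rcases lt_abs.1 h with h | h
  · right; simp only [Set.mem_ofPred_eq]; linarith
  · left; simp only [Set.mem_ofPred_eq]; linarith

end ExpFamily
end BayesUCB

/-! ### What a low or a high index implies -/

namespace BayesUCB
namespace ExpFamily

variable {F : ExpFamily} {f : ℝ → ℝ} {x : ℝ}

/-- If the quantile of order `1 - s` of the posterior is below `p`, then the empirical mean is low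
and `n d(x, r)` is large. -/
theorem lt_and_le_of_quantile_lt (hJ : F.J.Nontrivial) (hf : IntegrableOn f F.J)
    (hone : ∫ u in F.J, f u = 1) (hpos : ∀ u ∈ F.J, 0 < f u) (hx : x ∈ F.J) (n : ℕ)
    {p q r s : ℝ} (hI : Set.Icc p r ⊆ F.J) (hpq : p < q) (hqr : q < r) (hs : 0 < s)
    (hs' : s < (∫ u in Set.Icc p q, f u) / 2)
    (h : quantile (1 - s) (F.posterior f n x) < p) :
    x < q ∧ (∫ u in Set.Icc q r, f u) * Real.exp (-(n * F.d x r)) ≤ s := by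
  have := isProbabilityMeasure_posterior hJ hf hpos hx n
  have h1 := measureReal_Ici_le_of_quantile_lt _ (by linarith) h
  rw [sub_sub_cancel] at h1
  have hxq : x < q := by
    by_contra! hqx
    have := le_posterior_Ici_of_le hJ hf hone hpos hx n
      ((Set.Icc_subset_Icc_right hqr.le).trans hI) hpq hqx
    linarith
  exact ⟨hxq, (le_posterior_Ici_of_ge hJ hf hone hpos hx n
    ((Set.Icc_subset_Icc_left hpq.le).trans hI) hpq.le hqr hxq.le).trans h1⟩

/-- If the quantile of order `1 - s` of the posterior is at least `p`, then the number of
observations is at most of order `log (1 / s)`. -/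
theorem mul_lt_of_le_quantile (hJ : F.J.Nontrivial) (hf : IntegrableOn f F.J)
    (hone : ∫ u in F.J, f u = 1) (hpos : ∀ u ∈ F.J, 0 < f u) (hx : x ∈ F.J) (n : ℕ)
    {a b v p g s : ℝ} (hI : Set.Icc a b ⊆ F.J) (hab : a < b) (hv : v ∈ F.J) (hxv : x ≤ v)
    (hg : ∀ w ∈ Set.Icc a b, g ≤ F.logLik x w - F.logLik x v) (hvp : v < p) (hs : 0 < s)
    (hs' : s < 1) (h : p ≤ quantile (1 - s) (F.posterior f n x)) :
    n * g < -Real.log s - Real.log (∫ u in Set.Icc a b, f u) := by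
  have := isProbabilityMeasure_posterior hJ hf hpos hx n
  have hm := setIntegral_Icc_pos hf hpos hab hI
  have h1 := lt_measureReal_Ioi_of_le_quantile _ (by linarith) hvp h
  rw [sub_sub_cancel] at h1
  have h2 := h1.trans_le (posterior_Ioi_le hJ hf hone hpos hx n hI hab hv hxv hg)
  rw [lt_div_iff₀ hm] at h2
  have h3 := Real.log_lt_log (mul_pos hs hm) h2
  rw [Real.log_exp, Real.log_mul hs.ne' hm.ne'] at h3
  linarith

theorem exists_gap {u v g : ℝ} (hu : u ∈ F.J) (hv : v ∈ F.J) (huv : u < v) (hg : g < F.d u v) :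
    ∃ δ > 0, u + δ < v - δ ∧ Set.Icc (u - δ) (u + δ) ⊆ F.J ∧
      ∀ x ∈ Set.Icc (u - δ) (u + δ), ∀ w ∈ Set.Icc (u - δ) (u + δ),
        g ≤ F.logLik x w - F.logLik x (v - δ) := by
  have h1 : ContinuousAt (fun p : ℝ × ℝ × ℝ => F.logLik p.1 p.2.1) (u, u, v) :=
    ContinuousAt.comp (f := fun p : ℝ × ℝ × ℝ => (p.1, p.2.1))
      (F.continuousAt_logLik hu hv huv.ne hu) (by fun_prop)
  have h2 : ContinuousAt (fun p : ℝ × ℝ × ℝ => F.logLik p.1 p.2.2) (u, u, v) :=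
    ContinuousAt.comp (f := fun p : ℝ × ℝ × ℝ => (p.1, p.2.2))
      (F.continuousAt_logLik hu hv huv.ne hv) (by fun_prop)
  rw [F.d_eq hu hv] at hg
  -- At (u, u, v) the difference of log-likelihoods equals d(u,v) > g; the inequality persists
  -- nearby by joint continuity.
  obtain ⟨e, he, hball⟩ := Metric.eventually_nhds_iff.1 ((h1.sub h2).eventually_const_lt hg)
  obtain ⟨e', he', hball'⟩ := Metric.isOpen_iff.1 (F.isOpen_J hu hv huv.ne) u hu
  refine ⟨min (e / 2) (min (e' / 2) ((v - u) / 3)), by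
    have := sub_pos.2 huv; positivity, ?_, ?_, ?_⟩ <;>
    set δ := min (e / 2) (min (e' / 2) ((v - u) / 3)) with hδ
  all_goals
    have hδ1 : δ ≤ e / 2 := min_le_left _ _
    have hδ2 : δ ≤ e' / 2 := (min_le_right _ _).trans (min_le_left _ _)
    have hδ3 : δ ≤ (v - u) / 3 := (min_le_right _ _).trans (min_le_right _ _)
    have hδ0 : 0 < δ := by have := sub_pos.2 huv; positivity
  · linarith
  · intro x hx
    refine hball' ?_
    rw [Metric.mem_ball, Real.dist_eq, abs_lt]
    constructor <;> linarith [hx.1, hx.2]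
  · intro x hx w hw
    refine (hball (y := (x, w, v - δ)) ?_).le
    rw [Prod.dist_eq, Prod.dist_eq, max_lt_iff, max_lt_iff, Real.dist_eq, Real.dist_eq,
      Real.dist_eq, abs_lt, abs_lt, abs_lt]
    refine ⟨⟨?_, ?_⟩, ⟨?_, ?_⟩, ⟨?_, ?_⟩⟩ <;> linarith [hx.1, hx.2, hw.1, hw.2]

end ExpFamily

/-! ### Counting draws -/

section Counting

variable {Ω : Type*} {K : ℕ} (A : ℕ → Ω → Fin K) (a : Fin K) (ω : Ω)

theorem draws_succ (t : ℕ) :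
    draws A a (t + 1) ω = draws A a t ω + if A (t + 1) ω = a then 1 else 0 := by
  unfold draws
  rw [← Finset.insert_Icc_right_eq_Icc_add_one (by omega), Finset.filter_insert]
  split_ifs with h
  · rw [Finset.card_insert_of_notMem (by simp)]
  · rfl

theorem draws_monotone : Monotone fun t => draws A a t ω :=
  monotone_nat_of_le_succ fun t => by rw [draws_succ]; exact Nat.le_add_right _ _

theorem draws_le (t : ℕ) : draws A a t ω ≤ t := by
  refine (Finset.card_filter_le _ _).trans ?_
  simp

theorem draws_eq_card (T : ℕ) :
    draws A a T ω = ((Finset.range T).filter fun t => A (t + 1) ω = a).card := by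
  induction T with
  | zero => simp [draws]
  | succ T ih =>
    rw [draws_succ, ih, Finset.range_add_one, Finset.filter_insert]
    split_ifs with h
    · rw [Finset.card_insert_of_notMem (by simp)]
    · rfl

/-- Each draw of `a` increases its count, so t ↦ N_a(t) is injective on the rounds t followed by a
draw of `a`; its values are at most t < T. -/
theorem card_filter_draws_le (q : ℕ → Prop) [DecidablePred q] (T : ℕ) :
    ((Finset.range T).filter fun t => A (t + 1) ω = a ∧ q (draws A a t ω)).card ≤
      ((Finset.range T).filter q).card := by
  refine Finset.card_le_card_of_injOn (fun t => draws A a t ω) ?_ ?_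
  · intro t ht
    simp only [Finset.coe_filter, Finset.mem_range, Set.mem_ofPred_eq] at ht ⊢
    exact ⟨(draws_le A a ω t).trans_lt ht.1, ht.2.2⟩
  · have key : ∀ s t, A (s + 1) ω = a → s < t → draws A a s ω < draws A a t ω := by
      intro s t hs hst
      have h1 := draws_succ A a ω s
      rw [if_pos hs] at h1
      have h2 : draws A a (s + 1) ω ≤ draws A a t ω := draws_monotone A a ω hst
      omega
    intro s hs t ht hst
    simp only [Finset.coe_filter, Finset.mem_range, Set.mem_ofPred_eq] at hs ht hst
    rcases lt_trichotomy s t with h | h | h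
    · exact absurd hst (key s t hs.2.1 h).ne
    · exact h
    · exact absurd hst (key t s ht.2.1 h).ne'

open Classical in
/-- Every draw after round `t₀` occurs in a bad round, or after few draws, or after a bad number of
draws. -/
theorem draws_le_of_cover {t₀ T : ℕ} {B : ℝ} (hB : 0 ≤ B) (G H : ℕ → Set Ω)
    (h : ∀ t, t₀ ≤ t → t < T → A (t + 1) ω = a →
      ω ∈ G t ∨ (draws A a t ω : ℝ) ≤ B ∨ ω ∈ H (draws A a t ω)) :
    (draws A a T ω : ℝ) ≤ t₀ + B + 1 + ∑ t ∈ Finset.Ico t₀ T, (G t).indicator 1 ω +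
      ∑ n ∈ Finset.range T, (H n).indicator 1 ω := by
  have hsub : ((Finset.range T).filter fun t => A (t + 1) ω = a) ⊆
      Finset.range t₀ ∪ ((Finset.Ico t₀ T).filter fun t => ω ∈ G t) ∪
      ((Finset.range T).filter fun t => A (t + 1) ω = a ∧ (draws A a t ω : ℝ) ≤ B) ∪
      ((Finset.range T).filter fun t => A (t + 1) ω = a ∧ ω ∈ H (draws A a t ω)) := by
    intro t ht
    simp only [Finset.mem_filter, Finset.mem_range, Finset.mem_union, Finset.mem_Ico] at ht ⊢
    rcases lt_or_ge t t₀ with h0 | h0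
    · exact Or.inl (Or.inl (Or.inl h0))
    · rcases h t h0 ht.1 ht.2 with h1 | h1 | h1
      · exact Or.inl (Or.inl (Or.inr ⟨⟨h0, ht.1⟩, h1⟩))
      · exact Or.inl (Or.inr ⟨ht.1, ht.2, h1⟩)
      · exact Or.inr ⟨ht.1, ht.2, h1⟩
  have hB' : (((Finset.range T).filter fun n : ℕ => (n : ℝ) ≤ B).card : ℝ) ≤ B + 1 := by
    have : ((Finset.range T).filter fun n : ℕ => (n : ℝ) ≤ B) ⊆ Finset.range (⌊B⌋₊ + 1) := by
      intro n hn
      simp only [Finset.mem_filter, Finset.mem_range] at hn ⊢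
      exact Nat.lt_succ_of_le (Nat.le_floor hn.2)
    have h1 := Finset.card_le_card this
    rw [Finset.card_range] at h1
    have h2 := Nat.floor_le hB
    have h3 : (((Finset.range T).filter fun n : ℕ => (n : ℝ) ≤ B).card : ℝ) ≤ ⌊B⌋₊ + 1 := by
      exact_mod_cast h1
    linarith
  have h1 := Finset.card_le_card hsub
  rw [← draws_eq_card] at h1
  have h2 := h1.trans ((Finset.card_union_le _ _).trans (Nat.add_le_add
    ((Finset.card_union_le _ _).trans (Nat.add_le_add (Finset.card_union_le _ _)
      (card_filter_draws_le A a ω (fun n : ℕ => (n : ℝ) ≤ B) T)))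
    (card_filter_draws_le A a ω (fun n : ℕ => ω ∈ H n) T)))
  rw [Finset.card_range] at h2
  have h3 : (draws A a T ω : ℝ) ≤ t₀ + ((Finset.Ico t₀ T).filter fun t => ω ∈ G t).card +
      ((Finset.range T).filter fun n : ℕ => (n : ℝ) ≤ B).card +
      ((Finset.range T).filter fun n : ℕ => ω ∈ H n).card := by exact_mod_cast h2
  rw [Finset.card_filter, Finset.card_filter (fun n : ℕ => ω ∈ H n)] at h3
  push_cast at h3
  simp only [Set.indicator_apply, Pi.one_apply]
  linarith

end Counting

theorem integral_indicator_toMeasurable {Ω : Type*} [MeasurableSpace Ω] (P : Measure Ω)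
    (E : Set Ω) : ∫ ω, (toMeasurable P E).indicator (1 : Ω → ℝ) ω ∂P = P.real E := by
  rw [integral_indicator_one (measurableSet_toMeasurable P E), measureReal_def,
    measure_toMeasurable, measureReal_def]

/-- Measurable hulls have the same measure as the events, so no measurability of `G` and `H` is
needed. -/
theorem integral_le_add_sum_measureReal {Ω : Type*} [MeasurableSpace Ω] {P : Measure Ω}
    [IsProbabilityMeasure P] {N : Ω → ℝ} (hN : ∀ ω, 0 ≤ N ω) {C : ℝ} {s s' : Finset ℕ}
    (G H : ℕ → Set Ω) (h : ∀ ω, N ω ≤ C + ∑ t ∈ s, (G t).indicator 1 ω +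
      ∑ n ∈ s', (H n).indicator 1 ω) :
    ∫ ω, N ω ∂P ≤ C + ∑ t ∈ s, P.real (G t) + ∑ n ∈ s', P.real (H n) := by
  have hint : ∀ E : Set Ω, Integrable ((toMeasurable P E).indicator (1 : Ω → ℝ)) P := fun E =>
    (integrable_const (1 : ℝ)).indicator (measurableSet_toMeasurable P E)
  have hle : ∀ (E : Set Ω) (ω : Ω), E.indicator (1 : Ω → ℝ) ω ≤
      (toMeasurable P E).indicator 1 ω := fun E ω =>
    Set.indicator_le_indicator_of_subset (subset_toMeasurable P E) (fun _ => zero_le_one) ω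
  have hs : ∀ (s : Finset ℕ) (E : ℕ → Set Ω),
      Integrable (fun ω => ∑ t ∈ s, (toMeasurable P (E t)).indicator (1 : Ω → ℝ) ω) P :=
    fun s E => integrable_finsetSum s fun t _ => hint (E t)
  have hc : Integrable (fun ω => C + ∑ t ∈ s, (toMeasurable P (G t)).indicator (1 : Ω → ℝ) ω) P :=
    (integrable_const C).add (hs s G)
  calc ∫ ω, N ω ∂P ≤ ∫ ω, (C + ∑ t ∈ s, (toMeasurable P (G t)).indicator 1 ω +
      ∑ n ∈ s', (toMeasurable P (H n)).indicator 1 ω) ∂P := by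
        refine integral_mono_of_nonneg (ae_of_all _ hN) (hc.add (hs s' H))
          (ae_of_all _ fun ω => (h ω).trans ?_)
        exact add_le_add (add_le_add le_rfl (Finset.sum_le_sum fun t _ => hle _ ω))
          (Finset.sum_le_sum fun t _ => hle _ ω)
    _ = _ := by
        rw [integral_add hc (hs s' H), integral_add (integrable_const C) (hs s G),
          integral_finsetSum _ fun t _ => hint _, integral_finsetSum _ fun t _ => hint _]
        simp only [integral_indicator_toMeasurable]
        simp

end BayesUCB

/-! ### Geometric sums and sums of the levels -/

namespace BayesUCB

theorem sum_exp_neg_mul_le {κ : ℝ} (hκ : 0 < κ) (T : ℕ) :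
    ∑ n ∈ Finset.range T, Real.exp (-(n * κ)) ≤ (1 - Real.exp (-κ))⁻¹ := by
  have h1 : Real.exp (-κ) < 1 := Real.exp_lt_one_iff.2 (by linarith)
  have h : ∀ n : ℕ, Real.exp (-(n * κ)) = Real.exp (-κ) ^ n := fun n => by
    rw [← Real.exp_nat_mul]
    congr 1
    ring
  simp_rw [h]
  rw [← tsum_geometric_of_lt_one (Real.exp_pos _).le h1]
  exact (summable_geometric_of_lt_one (Real.exp_pos _).le h1).sum_le_tsum _
    fun _ _ => pow_nonneg (Real.exp_pos _).le _

section Level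

variable {c : ℝ} {t : ℕ}

theorem one_lt_log (ht : 3 ≤ t) : 1 < Real.log t := by
  rw [Real.lt_log_iff_exp_lt (by positivity)]
  have : (3 : ℝ) ≤ t := by exact_mod_cast ht
  linarith [Real.exp_one_lt_d9]

theorem level_pos (ht : 3 ≤ t) : 0 < 1 / ((t : ℝ) * Real.log t ^ c) := by
  have := Real.rpow_pos_of_pos (zero_lt_one.trans (one_lt_log ht)) c
  positivity

theorem level_nonneg (c : ℝ) (t : ℕ) : 0 ≤ 1 / ((t : ℝ) * Real.log t ^ c) := by
  have := Real.rpow_nonneg (Real.log_natCast_nonneg t) c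
  positivity

theorem level_le (hc : 0 ≤ c) (ht : 3 ≤ t) :
    1 / ((t : ℝ) * Real.log t ^ c) ≤ 1 / t := by
  have ht' : (0 : ℝ) < t := by positivity
  have := Real.one_le_rpow (one_lt_log ht).le hc
  exact one_div_le_one_div_of_le ht' (le_mul_of_one_le_right ht'.le this)

theorem neg_log_level (ht : 3 ≤ t) :
    -Real.log (1 / ((t : ℝ) * Real.log t ^ c)) = Real.log t + c * Real.log (Real.log t) := by
  have h := zero_lt_one.trans (one_lt_log ht)
  rw [one_div, Real.log_inv, neg_neg, Real.log_mul (by positivity)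
    (Real.rpow_pos_of_pos h c).ne', Real.log_rpow h]

theorem tendsto_log_natCast : Tendsto (fun T : ℕ => Real.log T) atTop atTop :=
  Real.tendsto_log_atTop.comp tendsto_natCast_atTop_atTop

/-- The terms are o(1/(t+1)); as the harmonic series diverges, summation preserves this, and
harmonic sums are O(log T). -/
theorem sum_level_isLittleO (hc : 0 < c) :
    (fun T : ℕ => ∑ t ∈ Finset.range T, 1 / ((t : ℝ) * Real.log t ^ c)) =o[atTop]
      fun T : ℕ => Real.log T := by
  have h1 : (fun t : ℕ => 1 / ((t : ℝ) * Real.log t ^ c)) =o[atTop]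
      fun t : ℕ => ((t : ℝ) + 1)⁻¹ := by
    have h2 : (fun t : ℕ => (Real.log t ^ c)⁻¹) =o[atTop] fun _ : ℕ => (1 : ℝ) := by
      rw [isLittleO_one_iff]
      exact tendsto_inv_atTop_zero.comp ((tendsto_rpow_atTop hc).comp tendsto_log_natCast)
    have h3 : (fun t : ℕ => (t : ℝ)⁻¹) =O[atTop] fun t : ℕ => ((t : ℝ) + 1)⁻¹ := by
      refine IsBigO.of_bound 2 ?_
      filter_upwards [eventually_ge_atTop 1] with t ht
      have ht' : (1 : ℝ) ≤ t := by exact_mod_cast ht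
      rw [Real.norm_of_nonneg (by positivity), Real.norm_of_nonneg (by positivity),
        ← div_eq_mul_inv, inv_eq_one_div, div_le_div_iff₀ (by positivity) (by positivity)]
      linarith
    refine (h3.mul_isLittleO h2).congr (fun t => ?_) fun t => ?_
    · rw [one_div, mul_inv]
    · rw [mul_one]
  have hharm : ∀ n : ℕ, ∑ i ∈ Finset.range n, ((i : ℝ) + 1)⁻¹ = (harmonic n : ℝ) := fun n => by
    simp [harmonic]
  have h4 := h1.sum_range (fun t => by positivity) (by
    simp_rw [hharm]
    refine tendsto_atTop_mono (fun n => log_add_one_le_harmonic n) ?_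
    exact tendsto_log_natCast.comp (tendsto_add_atTop_nat 1))
  refine h4.trans_isBigO (IsBigO.of_bound 2 ?_)
  filter_upwards [eventually_ge_atTop 3] with T hT
  have h5 := harmonic_floor_le_one_add_log T (by exact_mod_cast (by omega : 1 ≤ T))
  rw [Nat.floor_natCast] at h5
  have h6 := one_lt_log hT
  rw [hharm, Real.norm_of_nonneg (by rw [← hharm]; positivity), Real.norm_of_nonneg (by linarith)]
  linarith

end Level

/-! ### The finite-time bound and its asymptotics -/

theorem integral_draws_le {Ω : Type*} [MeasurableSpace Ω] (P : Measure Ω) [IsProbabilityMeasure P]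
    {F : ExpFamily} {K : ℕ} {μ : Fin K → ℝ} {m M : ℝ} (hm : m ∈ F.J) (hM : M ∈ F.J)
    (hμ : ∀ a, μ a ∈ Set.Icc m M) {f : Fin K → ℝ → ℝ} (hf_pos : ∀ a, ∀ u ∈ F.J, 0 < f a u)
    (hf_int : ∀ a, IntegrableOn (f a) F.J) (hf_one : ∀ a, ∫ u in F.J, f a u = 1)
    {Y : Fin K → ℕ → Ω → ℝ} (hY_law : ∀ a k, HasLaw (Y a k) (F.meanLaw (μ a)) P)
    (hY_indep : iIndepFun (fun p : Fin K × ℕ => Y p.1 p.2) P)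
    {c : ℝ} (hc : 0 ≤ c) {A : ℕ → Ω → Fin K} (hA : IsBayesUCB F f c m M Y A)
    {a o : Fin K} (hao : μ a < μ o) {ε : ℝ} (hε : 0 < ε) :
    ∃ C₁ C₂ C₃ : ℝ, ∀ T : ℕ, ∫ ω, (draws A a T ω : ℝ) ∂P ≤
      (1 + ε) / F.d (μ a) (μ o) * Real.log T + (C₁ * |Real.log (Real.log T)| +
        C₂ * ∑ t ∈ Finset.range T, 1 / ((t : ℝ) * Real.log t ^ c) + C₃) := by
  have hmMJ : Set.Icc m M ⊆ F.J := F.ordConnected_J.out hm hM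
  have hu := hmMJ (hμ a)
  have hv := hmMJ (hμ o)
  have hJ : F.J.Nontrivial := ⟨_, hu, _, hv, hao.ne⟩
  have hd := F.d_pos hu hv hao.ne
  set g := F.d (μ a) (μ o) / (1 + ε) with hg
  have hg0 : 0 < g := by positivity
  have hgd : g < F.d (μ a) (μ o) := div_lt_self hd (by linarith)
  obtain ⟨δ, hδ, hδv, hδJ, hgap⟩ := F.exists_gap hu hv hao hgd
  have huv : Set.Icc (μ a) (μ o) ⊆ F.J := F.ordConnected_J.out hu hv
  have hmem : ∀ r, 0 ≤ r → r ≤ δ → μ o - r ∈ F.J := fun r h0 h1 =>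
    huv ⟨by linarith, by linarith⟩
  -- Levels below `μ o`: δ for the posterior tail of `a`, 3δ/4 for the index threshold, δ/2 for the
  -- clipped mean of `o`, δ/4 for the intermediate point whose divergence κ to `μ o` gives geometric
  -- decay.
  have hI : Set.Icc (μ o - 3 * δ / 4) (μ o - δ / 4) ⊆ F.J :=
    F.ordConnected_J.out (hmem _ (by linarith) (by linarith)) (hmem _ (by linarith) (by linarith))
  have hpq : μ o - 3 * δ / 4 < μ o - δ / 2 := by linarith
  have hqr : μ o - δ / 2 < μ o - δ / 4 := by linarith
  have hw : μ o - δ / 4 ∈ F.J := hmem _ (by linarith) (by linarith)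
  set c₀ := ∫ u in Set.Icc (μ o - 3 * δ / 4) (μ o - δ / 2), f o u
  set c₁ := ∫ u in Set.Icc (μ o - δ / 2) (μ o - δ / 4), f o u
  set c₂ := ∫ u in Set.Icc (μ a - δ) (μ a + δ), f a u
  have hc₀ : 0 < c₀ := F.setIntegral_Icc_pos (hf_int o) (hf_pos o) hpq
    ((Set.Icc_subset_Icc_right hqr.le).trans hI)
  have hc₁ : 0 < c₁ := F.setIntegral_Icc_pos (hf_int o) (hf_pos o) hqr
    ((Set.Icc_subset_Icc_left hpq.le).trans hI)
  have hc₂ : 0 < c₂ := F.setIntegral_Icc_pos (hf_int a) (hf_pos a) (by linarith) hδJ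
  have hc₂' : c₂ ≤ 1 := F.setIntegral_le_one (hf_int a) (hf_one a) (hf_pos a) hδJ
  have hl₂ : 0 ≤ -Real.log c₂ := neg_nonneg.2 (Real.log_nonpos hc₂.le hc₂')
  set κ := F.d (μ o - δ / 4) (μ o)
  have hκ : 0 < κ := F.d_pos hw hv (by linarith)
  have hu1 : μ a - δ ∈ F.J := hδJ ⟨le_rfl, by linarith⟩
  have hu2 : μ a + δ ∈ F.J := hδJ ⟨by linarith, le_rfl⟩
  set κ₁ := F.d (μ a - δ) (μ a)
  set κ₂ := F.d (μ a + δ) (μ a)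
  have hκ₁ : 0 < κ₁ := F.d_pos hu1 hu (by linarith)
  have hκ₂ : 0 < κ₂ := F.d_pos hu2 hu (by linarith)
  have hind : ∀ i, iIndepFun (Y i) P := fun i =>
    hY_indep.precomp (g := fun k : ℕ => (i, k)) (Prod.mk_right_injective i)
  set x : Fin K → ℕ → Ω → ℝ := fun i n ω =>
    min (max ((∑ k ∈ Finset.range n, Y i k ω) / (n : ℝ)) m) M with hx
  have hmM : m ≤ M := (hμ a).1.trans (hμ a).2
  have hxJ : ∀ i n ω, x i n ω ∈ F.J := fun i n ω =>
    hmMJ ⟨le_min (le_max_right _ _) hmM, min_le_right _ _⟩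
  set s : ℕ → ℝ := fun t => 1 / ((t : ℝ) * Real.log t ^ c) with hs
  obtain ⟨t₁, ht₁⟩ := exists_nat_one_div_lt (K := ℝ) (half_pos hc₀)
  -- K activates the selection rule, 3 gives log t > 1, and t₁ + 1 brings the level below c₀/2.
  set t₀ := max K (max 3 (t₁ + 1)) with ht₀
  have hs₀ : ∀ t, t₀ ≤ t → s t < c₀ / 2 := fun t ht => by
    have h3 : 3 ≤ t := by omega
    have h4 : (t₁ : ℝ) + 1 ≤ t := by exact_mod_cast (by omega : t₁ + 1 ≤ t)
    exact ((level_le hc h3).trans (one_div_le_one_div_of_le (by positivity) h4)).trans_lt ht₁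
  set E : ℕ → ℕ → Set Ω := fun t n => {ω | x o n ω < μ o - δ / 2 ∧
    c₁ * Real.exp (-(n * F.d (x o n ω) (μ o - δ / 4))) ≤ s t} with hE
  -- The number of draws of `o` is random; the union over all its possible values removes the
  -- dependence on the strategy.
  set G : ℕ → Set Ω := fun t => ⋃ n ∈ Finset.range (t + 1), E t n with hG
  set H : ℕ → Set Ω := fun n => {ω | δ < |x a n ω - μ a|} with hH
  have hGP : ∀ t, P.real (G t) ≤ (1 - Real.exp (-κ))⁻¹ * (s t / c₁) := fun t => by
    refine (measureReal_biUnion_finset_le _ _).trans ?_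
    refine le_trans (Finset.sum_le_sum fun n _ => F.measureReal_clipped_le hJ (hY_law o) (hind o)
      hm hM hv hqr hw (by linarith) (hμ o).2 hc₁ (level_nonneg c t) n) ?_
    rw [← Finset.sum_mul]
    exact mul_le_mul_of_nonneg_right (sum_exp_neg_mul_le hκ _)
      (div_nonneg (level_nonneg c t) hc₁.le)
  have hHP : ∀ n, P.real (H n) ≤ Real.exp (-(n * κ₁)) + Real.exp (-(n * κ₂)) := fun n =>
    F.measureReal_abs_clipped_sub_le (hY_law a) (hind a) hu (hμ a) hδ.le hu1 hu2 n
  -- The absolute value keeps the bound nonnegative for small T, where log log T may be negative.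
  set B : ℕ → ℝ := fun T =>
    (Real.log T + c * |Real.log (Real.log T)| - Real.log c₂) / g with hB
  have hB0 : ∀ T, 0 ≤ B T := fun T => by
    have := Real.log_natCast_nonneg T
    have := mul_nonneg hc (abs_nonneg (Real.log (Real.log T)))
    exact div_nonneg (by linarith) hg0.le
  have hpath : ∀ T ω, (draws A a T ω : ℝ) ≤ t₀ + B T + 1 +
      ∑ t ∈ Finset.Ico t₀ T, (G t).indicator 1 ω + ∑ n ∈ Finset.range T, (H n).indicator 1 ω := by
    intro T ω
    refine draws_le_of_cover A a ω (hB0 T) G H fun t ht htT hAt => ?_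
    have h3 : 3 ≤ t := by omega
    have hst := level_pos (c := c) h3
    have hsel := hA.select ω t (by omega) o
    rw [hAt] at hsel
    by_cases hlow : index F f c m M Y A o t ω < μ o - 3 * δ / 4
    · left
      have h := F.lt_and_le_of_quantile_lt hJ (hf_int o) (hf_one o) (hf_pos o)
        (hxJ o (draws A o t ω) ω) (draws A o t ω) hI hpq hqr hst (hs₀ t ht) hlow
      refine Set.mem_biUnion (x := draws A o t ω) ?_ h
      simpa using Nat.lt_succ_of_le (draws_le A o ω t)
    · right
      by_cases hdev : δ < |x a (draws A a t ω) ω - μ a|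
      · exact Or.inr hdev
      left
      have habs := abs_le.1 (not_lt.1 hdev)
      have hxI : x a (draws A a t ω) ω ∈ Set.Icc (μ a - δ) (μ a + δ) :=
        ⟨by linarith [habs.1], by linarith [habs.2]⟩
      have hs1 : s t < 1 := by
        refine (level_le hc h3).trans_lt ?_
        rw [div_lt_one (by positivity)]
        exact_mod_cast (by omega : 1 < t)
      have h := F.mul_lt_of_le_quantile hJ (hf_int a) (hf_one a) (hf_pos a)
        (hxJ a (draws A a t ω) ω) (draws A a t ω) hδJ (by linarith)
        (hmem δ hδ.le le_rfl) (by linarith [hxI.2]) (hgap _ hxI)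
        (by linarith : μ o - δ < μ o - 3 * δ / 4) hst hs1 ((not_lt.1 hlow).trans hsel)
      rw [neg_log_level h3] at h
      rw [hB, le_div_iff₀ hg0]
      have htT' : (t : ℝ) ≤ T := by exact_mod_cast htT.le
      have hl1 : Real.log t ≤ Real.log T := Real.log_le_log (by positivity) htT'
      have hl2 : Real.log (Real.log t) ≤ |Real.log (Real.log T)| :=
        (Real.log_le_log (zero_lt_one.trans (one_lt_log h3)) hl1).trans (le_abs_self _)
      have := mul_le_mul_of_nonneg_left hl2 hc
      linarith
  refine ⟨c / g, (1 - Real.exp (-κ))⁻¹ / c₁, t₀ + 1 - Real.log c₂ / g +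
    ((1 - Real.exp (-κ₁))⁻¹ + (1 - Real.exp (-κ₂))⁻¹), fun T => ?_⟩
  refine (integral_le_add_sum_measureReal (fun ω => Nat.cast_nonneg _) G H (hpath T)).trans ?_
  have hsumG : ∑ t ∈ Finset.Ico t₀ T, P.real (G t) ≤
      (1 - Real.exp (-κ))⁻¹ / c₁ * ∑ t ∈ Finset.range T, s t := by
    have h1 : 0 ≤ (1 - Real.exp (-κ))⁻¹ :=
      inv_nonneg.2 (sub_nonneg.2 (Real.exp_lt_one_iff.2 (by linarith)).le)
    rw [Finset.mul_sum]
    refine (Finset.sum_le_sum fun t _ => (hGP t).trans_eq ?_).trans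
      (Finset.sum_le_sum_of_subset_of_nonneg (fun t ht => ?_) fun t _ _ =>
        mul_nonneg (div_nonneg h1 hc₁.le) (level_nonneg c t))
    · ring
    · simp only [Finset.mem_Ico, Finset.mem_range] at ht ⊢
      exact ht.2
  have hsumH : ∑ n ∈ Finset.range T, P.real (H n) ≤
      (1 - Real.exp (-κ₁))⁻¹ + (1 - Real.exp (-κ₂))⁻¹ := by
    refine (Finset.sum_le_sum fun n _ => hHP n).trans ?_
    rw [Finset.sum_add_distrib]
    exact add_le_add (sum_exp_neg_mul_le hκ₁ T) (sum_exp_neg_mul_le hκ₂ T)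
  have hBT : B T = (1 + ε) / F.d (μ a) (μ o) * Real.log T +
      c / g * |Real.log (Real.log T)| - Real.log c₂ / g := by
    have : (1 + ε) / F.d (μ a) (μ o) = 1 / g := by rw [hg, one_div_div]
    rw [this, hB]
    ring
  rw [hBT]
  linarith

theorem remainder_isLittleO {c : ℝ} (hc : 0 < c) (C₁ C₂ C₃ : ℝ) :
    (fun T : ℕ => C₁ * |Real.log (Real.log T)| +
      C₂ * ∑ t ∈ Finset.range T, 1 / ((t : ℝ) * Real.log t ^ c) + C₃) =o[atTop]
      fun T : ℕ => Real.log T := by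
  have h1 : (fun T : ℕ => |Real.log (Real.log T)|) =o[atTop] fun T : ℕ => Real.log T :=
    (Real.isLittleO_log_id_atTop.comp_tendsto tendsto_log_natCast).abs_left
  have h3 : (fun _ : ℕ => C₃) =o[atTop] fun T : ℕ => Real.log T :=
    isLittleO_const_left.2 (Or.inr (tendsto_norm_atTop_atTop.comp tendsto_log_natCast))
  exact ((h1.const_mul_left C₁).add ((sum_level_isLittleO hc).const_mul_left C₂)).add h3

theorem limsup_div_log_le {N : ℕ → ℝ} {d : ℝ} (hd : 0 < d)
    (h : ∀ ε : ℝ, 0 < ε → ∃ r : ℕ → ℝ, r =o[atTop] (fun T : ℕ => Real.log T) ∧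
      ∀ T : ℕ, N T ≤ (1 + ε) / d * Real.log T + r T) :
    limsup (fun T : ℕ => ((N T / Real.log T : ℝ) : EReal)) atTop ≤ ((1 / d : ℝ) : EReal) := by
  refine EReal.le_of_forall_lt_iff_le.1 fun z hz => ?_
  have hz' : 1 / d < z := by exact_mod_cast hz
  have hzd : 1 < z * d := by rwa [div_lt_iff₀ hd] at hz'
  -- This ε uses half of the gap z - 1/d; the other half, (zd - 1)/(2d), absorbs the remainder.
  obtain ⟨r, hr, hN⟩ := h ((z * d - 1) / 2) (by linarith)
  have hη : 0 < (z * d - 1) / (2 * d) := by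
    have := sub_pos.2 hzd
    positivity
  refine limsup_le_of_le (by isBoundedDefault) ?_
  filter_upwards [hr.bound hη, eventually_ge_atTop 3] with T hT h3
  have hl := one_lt_log h3
  have hl0 : 0 < Real.log T := by linarith
  rw [EReal.coe_le_coe_iff, div_le_iff₀ hl0]
  rw [Real.norm_of_nonneg hl0.le] at hT
  have h1 := (le_abs_self _).trans hT
  have h2 := hN T
  have h4 : (1 + (z * d - 1) / 2) / d + (z * d - 1) / (2 * d) = z := by
    field_simp
    ring
  rw [← h4, add_mul]
  linarith

end BayesUCB

theorem theorem1 {Ω : Type*} [MeasurableSpace Ω] (P : Measure Ω) [IsProbabilityMeasure P]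
    (F : BayesUCB.ExpFamily) (K : ℕ)
    -- the arms: all means lie in the known compact interval `[m, M]` inside `J`
    (μ : Fin K → ℝ) (m M : ℝ) (hm : m ∈ F.J) (hM : M ∈ F.J) (hμ : ∀ a, μ a ∈ Set.Icc m M)
    -- the prior densities
    (f : Fin K → ℝ → ℝ) (hf_pos : ∀ a, ∀ u ∈ F.J, 0 < f a u)
    (hf_int : ∀ a, IntegrableOn (f a) F.J) (hf_one : ∀ a, ∫ u in F.J, f a u = 1)
    -- the rewards: independent, those of arm `a` with the law of mean `μ a`
    (Y : Fin K → ℕ → Ω → ℝ) (hY_law : ∀ a k, HasLaw (Y a k) (F.meanLaw (μ a)) P)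
    (hY_indep : iIndepFun (fun p : Fin K × ℕ => Y p.1 p.2) P)
    -- the strategy
    (c : ℝ) (hc : 7 ≤ c) (A : ℕ → Ω → Fin K) (hA : BayesUCB.IsBayesUCB F f c m M Y A)
    -- a suboptimal arm
    (a : Fin K) (ha : μ a < ⨆ i, μ i) :
    (∀ ε : ℝ, 0 < ε → ∃ r : ℕ → ℝ, r =o[atTop] (fun T : ℕ => Real.log T) ∧
      ∀ T : ℕ, ∫ ω, (BayesUCB.draws A a T ω : ℝ) ∂P ≤
        (1 + ε) / F.d (μ a) (⨆ i, μ i) * Real.log T + r T) ∧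
    limsup (fun T : ℕ => (((∫ ω, (BayesUCB.draws A a T ω : ℝ) ∂P) / Real.log T : ℝ) : EReal))
      atTop ≤ ((1 / F.d (μ a) (⨆ i, μ i) : ℝ) : EReal) := by
  have : Nonempty (Fin K) := ⟨a⟩
  obtain ⟨o, ho⟩ := exists_eq_ciSup_of_finite (f := μ)
  rw [← ho] at ha ⊢
  have hJ : Set.Icc m M ⊆ F.J := F.ordConnected_J.out hm hM
  have hmain : ∀ ε : ℝ, 0 < ε → ∃ r : ℕ → ℝ, r =o[atTop] (fun T : ℕ => Real.log T) ∧
      ∀ T : ℕ, ∫ ω, (BayesUCB.draws A a T ω : ℝ) ∂P ≤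
        (1 + ε) / F.d (μ a) (μ o) * Real.log T + r T := fun ε hε => by
    obtain ⟨C₁, C₂, C₃, h⟩ := BayesUCB.integral_draws_le P hm hM hμ hf_pos hf_int hf_one hY_law
      hY_indep (by linarith) hA ha hε
    exact ⟨_, BayesUCB.remainder_isLittleO (by linarith) C₁ C₂ C₃, h⟩
  exact ⟨hmain, BayesUCB.limsup_div_log_le (F.d_pos (hJ (hμ a)) (hJ (hμ o)) ha.ne) hmain⟩
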